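/- Let $\mathbb{k}$ be an infinite field, let $\Delta$ be a simplicial complex of dimension $d-1$ on a finite set $V$ (with $\emptyset\in\Delta$; elements of $V$ need not be vertices of $\Delta$), let $A=\mathbb{k}[x_v:v\in V]$, $\mathfrak m=(x_v:v\in V)$, and let $\mathbb{k}[\Delta]=A/(\prod_{v\in F}x_v : F\notin\Delta)$ be the Stanley–Reisner ring, all with the standard $\mathbb Z$-grading. A linear system of parameters (l.s.o.p.) for $\mathbb{k}[\Delta]$ is a sequence of linear forms $\theta_1,\dots,\theta_d\in A$ with $\dim_{\mathbb{k}}\mathbb{k}[\Delta]/(\theta_1,\dots,\theta_d)<\infty$. For a graded $A$-module $M$ write $M[a]_n=M_{n+a}$ and $M_{\ge a}=\bigoplus_{n\ge a}M_n$. For linear forms $\theta_1,\dots,\theta_d$ and integers $i\ge 0$ put $$M^i(s)=H^i_{\mathfrak m}\big(\mathbb{k}[\Delta]/(\theta_1,\dots,\theta_s)\big)\quad(0\le s\le d),\qquad M^i=M^i(0)=H^i_{\mathfrak m}(\mathbb{k}[\Delta]),$$ $$K^i(j)=\ker\big(\theta_j: M^i(j-1)\to M^i(j-1)\big),\qquad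 L^i_s=\{x\in (M^i)_{\ge -1} : \theta_1x=\dots=\theta_sx=0\}.$$ For a generic choice of $\theta_1,\dots,\theta_d$, i.e. for all $(\theta_1,\dots,\theta_d)$ whose coefficient matrix lies in a suitable nonempty Zariski open subset of $\mathbb{k}^{d\times V}$ (depending only on $\mathbb k$ and $\Delta$), the sequence $\theta_1,\dots,\theta_d$ is an l.s.o.p. for $\mathbb{k}[\Delta]$, and for all $i\ge 0$ and all $1\le j\le d$ there is an $A$-submodule $B^i(j)\subseteq K^i(j)$ such that: (i) There is a natural isomorphism of graded $A$-modules $$\big(K^i(j)/B^i(j)\big)_{\ge j-2}\;\cong\; L^{i+j-1}_j[1-j],$$ namely one induced by the iterated connecting homomorphism $M^i(j-1)\to M^{i+1}(j-2)[-1]\to\dots\to M^{i+j-1}(0)[1-j]$. Here the connecting homomorphism $M^i(s)\to M^{i+1}(s-1)[-1]$ sends the class of a Čech cocycle $u$ of $\mathbb{k}[\Delta]/(\theta_1,\dots,\theta_s)$ to the class of $w$, where $z$ is a Čech cochain of $\mathbb{k}[\Delta]/(\theta_1,\dots,\theta_{s-1})$ lifting $u$ and $w$ is a cocycle with $dz=\theta_s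 w$. (ii) $B^i(j)$ is concentrated in degree $j-2$. In particular, $x_v\,B^i(j)=0$ for all $v\in V$. (iii) $B^i(j)$ and the cokernels below are finite-dimensional over $\mathbb{k}$, and $$\dim_{\mathbb{k}}B^i(j)=\dim_{\mathbb{k}}B^i(j)_{j-2}=\sum_{p=1}^{j-1}\dim_{\mathbb{k}}\operatorname{coker}\big(\theta_p: L^{i+j-2}_{p-1}\to (M^{i+j-2})_0\big).$$ -/

import Mathlib

open MvPolynomial

namespace SRCohomology

noncomputable section

/-! ### Graded modules

Throughout, `A = MvPolynomial V k` is the polynomial ring `k[x_v : v ∈ V]` with its standard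
`ℤ`-grading, and a `ℤ`-grading of an `A`-module `M` is recorded by the family
`𝓜 : ℤ → Submodule k M` of its homogeneous components. -/

/-- The truncation `M_{≥ n}`: since `A` is generated in degree `1`, the `A`-submodule spanned by all
homogeneous elements of degree at least `n` is the sum of the components of degree at least `n`. -/
def truncGE {k V M : Type*} [Field k] [AddCommGroup M] [Module k M] [Module (MvPolynomial V k) M]
    (𝓜 : ℤ → Submodule k M) (n : ℤ) : Submodule (MvPolynomial V k) M :=
  Submodule.span (MvPolynomial V k) {x | ∃ m : ℤ, n ≤ m ∧ x ∈ 𝓜 m}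

/-- The grading induced on the subquotient `K / B` of a graded module `M`, for graded submodules
`B ⊆ K`: the component of degree `n` is the image of `K ∩ M_n`. -/
def subquotientDeg {k V M : Type*} [Field k] [AddCommGroup M] [Module k M]
    [Module (MvPolynomial V k) M] [IsScalarTower k (MvPolynomial V k) M]
    (𝓜 : ℤ → Submodule k M) (K B : Submodule (MvPolynomial V k) M) (n : ℤ) :
    Submodule k (K ⧸ B.submoduleOf K) :=
  ((𝓜 n).comap (K.subtype.restrictScalars k)).map ((B.submoduleOf K).mkQ.restrictScalars k)

/-- The grading of a cyclic module `A ⧸ J` (for `J` a homogeneous ideal): the component of degree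
`n` consists of the classes of homogeneous polynomials of degree `n`; it is `0` for `n < 0`. -/
def quotientDeg {k V : Type*} [Field k] (J : Ideal (MvPolynomial V k)) (n : ℤ) :
    Submodule k (MvPolynomial V k ⧸ J) :=
  Submodule.span k {x | ∃ (m : ℕ) (f : MvPolynomial V k),
    (m : ℤ) = n ∧ f.IsHomogeneous m ∧ x = Ideal.Quotient.mk J f}

/-! ### Local cohomology at the irrelevant ideal, through the Čech complex on the variables -/

/-- The monomials in the variables `x_v`, `v ∈ S`. Inverting them is inverting `∏ v ∈ S, x_v`. -/
def monomialsOn (k : Type*) {V : Type*} [Field k] (S : Finset V) :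
    Submonoid (MvPolynomial V k) :=
  Submonoid.closure ((X : V → MvPolynomial V k) '' (S : Set V))

theorem monomialsOn_mono (k : Type*) {V : Type*} [Field k] {S T : Finset V} (h : S ⊆ T) :
    monomialsOn k S ≤ monomialsOn k T :=
  Submonoid.closure_mono (Set.image_mono (by exact_mod_cast h))

section Cech

variable (k : Type*) {V : Type*} [Field k] [LinearOrder V]
variable (M : Type*) [AddCommGroup M] [Module (MvPolynomial V k) M]

/-- The localization `M_{x_S}` of `M` at the product of the variables `x_v`, `v ∈ S`. -/
abbrev Loc (S : Finset V) : Type _ := LocalizedModule (monomialsOn k S) M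

/-- All Čech cochains of `M` with respect to the variables: `∏ S ⊆ V, M_{x_S}`. -/
abbrev Cech : Type _ := (S : Finset V) → Loc k M S

/-- The Čech differential: `(d c)_T = ∑_{v ∈ T} (-1)^{#{u ∈ T : u < v}} c_{T ∖ v}|_{M_{x_T}}`. -/
def cechD : Cech (V := V) k M →ₗ[MvPolynomial V k] Cech (V := V) k M :=
  LinearMap.pi fun T => ∑ v ∈ T, (-1 : MvPolynomial V k) ^ (T.filter (· < v)).card •
    (LocalizedModule.liftOfLE (M := M) (monomialsOn k (T.erase v)) (monomialsOn k T)
      (monomialsOn_mono k (T.erase_subset v)) ∘ₗ LinearMap.proj (T.erase v))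

/-- The cochains of cohomological degree `p`: those supported on the `S` with `|S| = p`, that is,
`C^p(M) = ⨁_{|S| = p} M_{x_S}`. -/
def cochains (p : ℕ) : Submodule (MvPolynomial V k) (Cech (V := V) k M) :=
  ⨅ (S : Finset V) (_ : S.card ≠ p), LinearMap.ker (LinearMap.proj S)

def cocycles (p : ℕ) : Submodule (MvPolynomial V k) (Cech (V := V) k M) :=
  cochains k M p ⊓ LinearMap.ker (cechD k M)

def coboundaries : ℕ → Submodule (MvPolynomial V k) (Cech (V := V) k M)
  | 0 => ⊥
  | p + 1 => (cochains k M p).map (cechD k M)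

/-- The local cohomology module `H^p_𝔪(M)`, where `𝔪 = (x_v : v ∈ V)`. -/
abbrev LocalCoh (p : ℕ) : Type _ :=
  cocycles (V := V) k M p ⧸ (coboundaries k M p).submoduleOf (cocycles k M p)

variable {k M}

/-- The cohomology class of a cocycle. -/
def cls (p : ℕ) : cocycles (V := V) k M p →ₗ[MvPolynomial V k] LocalCoh (V := V) k M p :=
  ((coboundaries k M p).submoduleOf (cocycles k M p)).mkQ

/-- The map on Čech cochains induced by a homomorphism of modules. -/
def cechMap {N : Type*} [AddCommGroup N] [Module (MvPolynomial V k) N]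
    (f : M →ₗ[MvPolynomial V k] N) :
    Cech (V := V) k M →ₗ[MvPolynomial V k] Cech (V := V) k N :=
  LinearMap.pi fun S =>
    IsLocalizedModule.map (monomialsOn k S)
      (LocalizedModule.mkLinearMap (monomialsOn k S) M)
      (LocalizedModule.mkLinearMap (monomialsOn k S) N) f ∘ₗ LinearMap.proj S

/-- The (graph of the) connecting homomorphism `δ : H^i_𝔪(M/θM) → H^{i+1}_𝔪(M)` attached to
multiplication by `θ` on `M`, where `π : M → N` is the projection onto `N = M/θM`:
`δ x = y` when `x` is the class of the image under `π` of a cochain `z` of `M`,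
and `d z = θ w` for a cocycle `w` of class `y`. -/
def Connecting {N : Type*} [AddCommGroup N] [Module (MvPolynomial V k) N]
    (π : M →ₗ[MvPolynomial V k] N) (θ : MvPolynomial V k) (i : ℕ)
    (x : LocalCoh (V := V) k N i) (y : LocalCoh (V := V) k M (i + 1)) : Prop :=
  ∃ z ∈ cochains (V := V) k M i, ∃ (u : cocycles (V := V) k N i)
    (w : cocycles (V := V) k M (i + 1)),
    cechMap π z = u ∧ cechD k M z = θ • (w : Cech (V := V) k M) ∧ cls i u = x ∧ cls (i + 1) w = y

variable [Module k M] [IsScalarTower k (MvPolynomial V k) M] (𝓜 : ℤ → Submodule k M)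

/-- The component of degree `n` of `M_{x_S}`: fractions `m / s` with `s` a monomial of degree `e`
in the variables of `S` and `m` homogeneous of degree `n + e`. -/
def locDeg (S : Finset V) (n : ℤ) : Submodule k (Loc k M S) :=
  Submodule.span k {x | ∃ (e : ℕ) (m : M) (s : monomialsOn k S),
    (s : MvPolynomial V k).IsHomogeneous e ∧ m ∈ 𝓜 (n + e) ∧ x = LocalizedModule.mk m s}

/-- The component of degree `n` of `H^p_𝔪(M)`: classes of cocycles all of whose entries are
homogeneous of degree `n`. -/
def cohDeg (p : ℕ) (n : ℤ) : Submodule k (LocalCoh (V := V) k M p) :=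
  ((Submodule.pi Set.univ fun S => locDeg 𝓜 S n).comap
    ((cocycles (V := V) k M p).subtype.restrictScalars k)).map ((cls p).restrictScalars k)

end Cech

/-! ### Stanley–Reisner rings and linear systems of parameters -/

/-- The Stanley–Reisner ideal of `Δ`, generated by the monomials `x_F` with `F ∉ Δ`.
(Mathlib's complexes do not list the empty set, which always counts as a face.) -/
def stanleyReisnerIdeal (k : Type*) {V : Type*} [Field k] (Δ : PreAbstractSimplicialComplex V) :
    Ideal (MvPolynomial V k) :=
  Ideal.span {f | ∃ F : Finset V, F.Nonempty ∧ F ∉ Δ ∧ f = ∏ v ∈ F, X v}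

/-- The linear form with coefficient vector `a`. -/
def linForm {k V : Type*} [Field k] [Fintype V] (a : V → k) : MvPolynomial V k :=
  ∑ v, C (a v) * X v

section Params

variable {k V : Type*} [Field k] [Fintype V]
variable (Δ : PreAbstractSimplicialComplex V) {d : ℕ} (Θ : Fin d → V → k)

/-- The ideal `I_Δ + (θ_1, …, θ_s)`, where `θ_{p+1} = linForm (Θ p)` for `p = 0, …, d - 1`. -/
def paramIdeal (s : ℕ) : Ideal (MvPolynomial V k) :=
  stanleyReisnerIdeal k Δ ⊔ Ideal.span {f | ∃ p : Fin d, (p : ℕ) < s ∧ f = linForm (Θ p)}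

theorem paramIdeal_le_succ (s : ℕ) : paramIdeal Δ Θ s ≤ paramIdeal Δ Θ (s + 1) :=
  sup_le_sup_left (Ideal.span_mono (by
    rintro _ ⟨p, hp, h⟩
    exact ⟨p, Nat.lt_succ_of_lt hp, h⟩)) _

/-- The ring `k[Δ] / (θ_1, …, θ_s)`, as a module over the polynomial ring. -/
abbrev SRQuotient (s : ℕ) : Type _ := MvPolynomial V k ⧸ paramIdeal Δ Θ s

/-- For `dim Δ = d - 1`, the ring `k[Δ]` has Krull dimension `d`, and the `d` linear forms are a
linear system of parameters if `k[Δ] / (θ_1, …, θ_d)` is a finite-dimensional vector space. -/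
def IsLSOP : Prop := Module.Finite k (SRQuotient Δ Θ d)

variable [LinearOrder V]

/-- `M^i(s) = H^i_𝔪(k[Δ] / (θ_1, …, θ_s))`. -/
abbrev MCoh (i s : ℕ) : Type _ := LocalCoh (V := V) k (SRQuotient Δ Θ s) i

/-- The component of degree `n` of `M^i(s)`. -/
def mDeg (i s : ℕ) (n : ℤ) : Submodule k (MCoh Δ Θ i s) :=
  cohDeg (quotientDeg (paramIdeal Δ Θ s)) i n

/-- The kernel of multiplication by `θ_{j+1}` on `M^i(j) = H^i_𝔪(k[Δ] / (θ_1, …, θ_j))`. -/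
def kerMul (i : ℕ) (j : Fin d) : Submodule (MvPolynomial V k) (MCoh Δ Θ i j) :=
  LinearMap.ker (LinearMap.lsmul (MvPolynomial V k) (MCoh Δ Θ i j) (linForm (Θ j)))

/-- `L^i_s`: the elements of `H^i_𝔪(k[Δ])_{≥ -1}` that are annihilated by `θ_1, …, θ_s`. -/
def LSub (i s : ℕ) : Submodule (MvPolynomial V k) (MCoh Δ Θ i 0) :=
  truncGE (mDeg Δ Θ i 0) (-1) ⊓ ⨅ (p : Fin d) (_ : (p : ℕ) < s),
    LinearMap.ker (LinearMap.lsmul (MvPolynomial V k) (MCoh Δ Θ i 0) (linForm (Θ p)))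

/-- The cokernel of `θ_{p+1} : L^i_p → H^i_𝔪(k[Δ])_0`. -/
abbrev CokerL (i : ℕ) (p : Fin d) : Type _ :=
  mDeg Δ Θ i 0 0 ⧸
    (((LSub Δ Θ i p).map (LinearMap.lsmul (MvPolynomial V k) (MCoh Δ Θ i 0)
      (linForm (Θ p)))).restrictScalars k).submoduleOf (mDeg Δ Θ i 0 0)

/-- The (graph of the) iterated connecting homomorphism
`M^i(s) → M^{i+1}(s-1) → ⋯ → M^{i+s}(0) = H^{i+s}_𝔪(k[Δ])`. -/
inductive IterConnecting : (s i n : ℕ) → MCoh Δ Θ i s → MCoh Δ Θ n 0 → Prop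
  | zero (i : ℕ) (x : MCoh Δ Θ i 0) : IterConnecting 0 i i x x
  | succ (s i n : ℕ) (hs : s < d) (x : MCoh Δ Θ i (s + 1)) (y : MCoh Δ Θ (i + 1) s)
      (z : MCoh Δ Θ n 0)
      (hxy : Connecting (Submodule.factor (paramIdeal_le_succ Δ Θ s)) (linForm (Θ ⟨s, hs⟩)) i x y)
      (hyz : IterConnecting s (i + 1) n y z) : IterConnecting (s + 1) i n x z

end Params

end

end SRCohomology

/-!
Genericity is the condition `FaceMinorsNonzero`: for each face `F` of `Δ`, the minor of the
coefficient matrix in its first `#F` rows and the columns of `F` is nonzero. It is a nonempty Zariski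
open condition (`exists_eval_ne_zero_faceMinorsNonzero`). By induction on faces from the largest
downwards it implies that every variable is nilpotent modulo `(θ_1, …, θ_d)`, so that the linear
forms are a system of parameters (`isLSOP_of_faceMinorsNonzero`), and that each `θ_{s+1}` is a
nonzerodivisor on `k[Δ] / (θ_1, …, θ_s)` up to elements killed by powers of the variables
(`exists_pow_mul_mem_paramIdeal`). The latter makes `θ_{s+1}` injective on Čech cochains of positive
degree, which is what the long exact sequence

  `M^i(s)[-1] → M^i(s) → M^i(s+1) → M^{i+1}(s)[-1] → M^{i+1}(s)`

needs; it is built by hand from the Čech complex (namespace `FilterRegular`).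

The other ingredient is that `M^i(0) = H^i(k[Δ])` vanishes in positive degrees and has finite
dimension in degree `0`. This comes from the fine `ℤ^V`-grading: in a fine degree `g` with `g v > 0`
the restrictions `k[Δ]_{x_S} → k[Δ]_{x_{S ∪ v}}` are bijective, since `I_Δ` is squarefree, and their
inverses are a contracting homotopy (`IsSquarefreeMonomial.mem_coboundaries_of_pos`). So in degree
`0` only the fine degree `0` contributes, in which the Čech complex is finite-dimensional.

The rest is a chase in the two top degrees (namespace `ConnectingTower`). By induction on `s`, the
module `M^i(s)` vanishes above degree `s`, and the iterated connecting homomorphism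
`φ : M^i(s) → M^{i+s}(0)[-s]` is bijective in degree `s` and maps degree `s - 1` onto the elements of
degree `-1` annihilated by `θ_1, …, θ_s`. Let `B^i(s+1)` be the kernel of `φ` in degree `s - 1`. As
multiplication by a linear form lands in degree `s`, where `φ` is injective, the variables kill
`B^i(s+1)`, and an element of degree `s - 1` lies in the kernel of `θ_{s+1}` if and only if its image
does; this gives the isomorphism. For the dimension, the long exact sequence restricted to the
kernels of `φ` is an exact sequence

  `0 → coker (θ_{s+1} : L^{i+s}_s → M^{i+s}_0) → B^i(s+2) → B^{i+1}(s+1) → 0`,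

which is summed over `s` (`ConnectingTower.finite_and_finrank_B`).
-/

namespace SRCohomology

noncomputable section

/-! ### Generic linear forms on a Stanley–Reisner ring -/

section LinearForms

variable {k V : Type*} [Field k]

/-- A variable indexed by a member of `F` is a nonzerodivisor modulo an ideal generated by
squarefree monomials in the variables outside `F` and by other variables. -/
theorem mem_of_X_mul_mem {F : Finset V} {𝒢 : Set (Finset V)} (h𝒢 : ∀ G ∈ 𝒢, Disjoint G F)
    (T : Set V) {v : V} (hvF : v ∈ F) (hvT : v ∉ T) {g : MvPolynomial V k}
    (hg : X v * g ∈ Ideal.span {f | ∃ G ∈ 𝒢, f = ∏ w ∈ G, X w} ⊔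
      Ideal.span ((X : V → MvPolynomial V k) '' T)) :
    g ∈ Ideal.span {f | ∃ G ∈ 𝒢, f = ∏ w ∈ G, X w} ⊔
      Ideal.span ((X : V → MvPolynomial V k) '' T) := by
  classical
  have hmon : Ideal.span {f : MvPolynomial V k | ∃ G ∈ 𝒢, f = ∏ w ∈ G, X w} ⊔
      Ideal.span ((X : V → MvPolynomial V k) '' T) =
      Ideal.span ((fun a => monomial a (1 : k)) ''
        ({a | ∃ G ∈ 𝒢, a = ∑ w ∈ G, Finsupp.single w 1} ∪
          {a | ∃ t ∈ T, a = Finsupp.single t 1})) := by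
    rw [Set.image_union, Ideal.span_union]
    congr 2
    · ext f
      simp only [Set.mem_ofPred_eq, Set.mem_image]
      constructor
      · rintro ⟨G, hG, rfl⟩
        exact ⟨_, ⟨G, hG, rfl⟩, by rw [monomial_sum_one]; rfl⟩
      · rintro ⟨_, ⟨G, hG, rfl⟩, rfl⟩
        exact ⟨G, hG, by rw [monomial_sum_one]; rfl⟩
    · ext f
      simp only [Set.mem_ofPred_eq, Set.mem_image]
      constructor
      · rintro ⟨t, ht, rfl⟩
        exact ⟨_, ⟨t, ht, rfl⟩, rfl⟩
      · rintro ⟨_, ⟨t, ht, rfl⟩, rfl⟩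
        exact ⟨t, ht, rfl⟩
  rw [hmon, mem_ideal_span_monomial_image] at hg ⊢
  intro a ha
  obtain ⟨b, hb, hba⟩ := hg (Finsupp.single v 1 + a) (by
    rw [mem_support_iff, coeff_X_mul]
    exact mem_support_iff.1 ha)
  refine ⟨b, hb, ?_⟩
  have hbv : b v = 0 := by
    rcases hb with ⟨G, hG, rfl⟩ | ⟨t, ht, rfl⟩
    · rw [Finsupp.finsetSum_apply]
      refine Finset.sum_eq_zero fun w hw => Finsupp.single_eq_of_ne ?_
      rintro rfl
      exact Finset.disjoint_left.1 (h𝒢 G hG) hw hvF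
    · refine Finsupp.single_eq_of_ne ?_
      rintro rfl
      exact hvT ht
  intro w
  by_cases hw : w = v
  · rw [hw, hbv]
    exact Nat.zero_le _
  · have := hba w
    rwa [Finsupp.add_apply, Finsupp.single_eq_of_ne hw, zero_add] at this

variable [Fintype V]

/-- Linear forms whose coefficients on `F` form an invertible matrix can be solved for the variables
of `F`, modulo the remaining variables. -/
theorem exists_X_eq_sum_linForm [DecidableEq V] {F : Finset V} {r : ℕ} (ε : Fin r ≃ F)
    (L : Fin r → V → k) (hL : (Matrix.of fun i m => L i (ε m)).det ≠ 0) :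
    ∃ a : Matrix (Fin r) (Fin r) k, (Matrix.of fun i m => L i (ε m)) * a = 1 ∧
      ∀ m, (X (ε m : V) : MvPolynomial V k) =
        ∑ i, C (a m i) * (linForm (L i) - ∑ w ∈ Fᶜ, C (L i w) * X w) := by
  set D : Matrix (Fin r) (Fin r) k := Matrix.of fun i m => L i (ε m)
  have hD : D⁻¹ * D = 1 := Matrix.nonsing_inv_mul _ (isUnit_iff_ne_zero.2 hL)
  refine ⟨D⁻¹, Matrix.mul_nonsing_inv _ (isUnit_iff_ne_zero.2 hL), fun m => ?_⟩
  have h1 : ∀ i, linForm (L i) - ∑ w ∈ Fᶜ, C (L i w) * X w =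
      ∑ m', C (D i m') * (X (ε m' : V) : MvPolynomial V k) := by
    intro i
    rw [linForm, ← Finset.sum_add_sum_compl F, add_sub_cancel_right,
      ← Finset.sum_coe_sort F, ← Equiv.sum_comp ε]
    rfl
  simp_rw [h1, Finset.mul_sum]
  rw [Finset.sum_comm]
  have h2 : ∀ m', ∑ i, C (D⁻¹ m i) * (C (D i m') * (X (ε m' : V) : MvPolynomial V k)) =
      C ((D⁻¹ * D) m m') * X (ε m' : V) := by
    intro m'
    simp_rw [← mul_assoc, ← C_mul]
    rw [← Finset.sum_mul, ← map_sum]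
    rfl
  rw [Finset.sum_congr rfl fun m' _ => h2 m', hD]
  rw [Finset.sum_eq_single m]
  · simp
  · intro b _ hb
    simp [Matrix.one_apply_ne hb.symm]
  · simp

/-- Under the hypothesis of `exists_X_eq_sum_linForm`, a linear automorphism `ψ` (with inverse `φ`)
fixes the variables outside `F` and takes the linear forms to the variables of `F`. -/
theorem exists_linear_substitution [DecidableEq V] {F : Finset V} {r : ℕ} (ε : Fin r ≃ F)
    (L : Fin r → V → k) (hL : (Matrix.of fun i m => L i (ε m)).det ≠ 0) :
    ∃ φ ψ : MvPolynomial V k →ₐ[k] MvPolynomial V k,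
      (∀ w ∉ F, φ (X w) = X w) ∧ (∀ w ∉ F, ψ (X w) = X w) ∧
      (∀ i, φ (X (ε i : V)) = linForm (L i)) ∧ (∀ i, ψ (linForm (L i)) = X (ε i : V)) ∧
      ∀ f, φ (ψ f) = f := by
  obtain ⟨a, hDa, ha⟩ := exists_X_eq_sum_linForm ε L hL
  let φ : MvPolynomial V k →ₐ[k] MvPolynomial V k :=
    aeval fun v => if h : v ∈ F then linForm (L (ε.symm ⟨v, h⟩)) else X v
  let φ' : MvPolynomial V k →ₐ[k] MvPolynomial V k :=
    aeval fun v => if h : v ∈ F then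
      ∑ i, C (a (ε.symm ⟨v, h⟩) i) * (X (ε i : V) - ∑ w ∈ Fᶜ, C (L i w) * X w) else X v
  have hφ : ∀ w ∉ F, φ (X w) = X w := fun w hw => by simp [φ, hw]
  have hφ' : ∀ w ∉ F, φ' (X w) = X w := fun w hw => by simp [φ', hw]
  have hφε : ∀ i, φ (X (ε i : V)) = linForm (L i) := fun i => by simp [φ]
  have hC : ∀ (g : MvPolynomial V k →ₐ[k] MvPolynomial V k) (c : k), g (C c) = C c :=
    fun g c => g.commutes c
  have hsum : ∀ (g : MvPolynomial V k →ₐ[k] MvPolynomial V k), (∀ w ∉ F, g (X w) = X w) →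
      ∀ i, g (∑ w ∈ Fᶜ, C (L i w) * X w) = ∑ w ∈ Fᶜ, C (L i w) * X w := by
    intro g hg i
    rw [map_sum]
    refine Finset.sum_congr rfl fun w hw => ?_
    rw [map_mul, hC, hg w (by simpa using hw)]
  have hcomp : ∀ f, φ (φ' f) = f := by
    intro f
    have : φ.comp φ' = AlgHom.id k _ := by
      refine MvPolynomial.algHom_ext fun v => ?_
      by_cases hv : v ∈ F
      · have h1 : φ' (X v) = ∑ i, C (a (ε.symm ⟨v, hv⟩) i) *
            (X (ε i : V) - ∑ w ∈ Fᶜ, C (L i w) * X w) := by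
          simp [φ', hv]
        have h2 := ha (ε.symm ⟨v, hv⟩)
        rw [Equiv.apply_symm_apply] at h2
        rw [AlgHom.comp_apply, h1, map_sum, AlgHom.id_apply]
        refine Eq.trans ?_ h2.symm
        refine Finset.sum_congr rfl fun i _ => ?_
        rw [map_mul, map_sub, hC, hφε, hsum φ hφ]
      · rw [AlgHom.comp_apply, hφ' v hv, hφ v hv, AlgHom.id_apply]
    exact DFunLike.congr_fun this f
  have hφ'ε : ∀ m, φ' (X (ε m : V)) =
      ∑ i, C (a m i) * (X (ε i : V) - ∑ w ∈ Fᶜ, C (L i w) * X w) := fun m => by simp [φ']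
  refine ⟨φ, φ', hφ, hφ', hφε, fun i => ?_, hcomp⟩
  have h1 : linForm (L i) = (∑ m, C (L i (ε m)) * (X (ε m : V) : MvPolynomial V k)) +
      ∑ w ∈ Fᶜ, C (L i w) * X w := by
    rw [linForm, ← Finset.sum_add_sum_compl F, ← Finset.sum_coe_sort F, ← Equiv.sum_comp ε]
  rw [h1, map_add, hsum φ' hφ', map_sum]
  simp_rw [map_mul, hC, hφ'ε, Finset.mul_sum]
  rw [Finset.sum_comm]
  have h2 : ∀ j, ∑ m, C (L i (ε m)) * (C (a m j) *
      ((X (ε j : V) : MvPolynomial V k) - ∑ w ∈ Fᶜ, C (L j w) * X w)) =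
      C ((1 : Matrix (Fin r) (Fin r) k) i j) *
        ((X (ε j : V) : MvPolynomial V k) - ∑ w ∈ Fᶜ, C (L j w) * X w) := by
    intro j
    rw [← hDa, Matrix.mul_apply]
    simp_rw [← mul_assoc, ← C_mul]
    rw [← Finset.sum_mul, ← map_sum]
    rfl
  rw [Finset.sum_congr rfl fun j _ => h2 j]
  rw [Finset.sum_eq_single i]
  · simp
  · intro b _ hb
    simp [Matrix.one_apply_ne hb.symm]
  · simp

/-- Linear forms with an invertible coefficient matrix on `F` form a regular sequence modulo an
ideal generated by squarefree monomials in the variables outside `F`. -/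
theorem mem_of_linForm_mul_mem [DecidableEq V] {F : Finset V} {r : ℕ} (ε : Fin r ≃ F)
    (L : Fin r → V → k) (hL : (Matrix.of fun i m => L i (ε m)).det ≠ 0)
    {𝒢 : Set (Finset V)} (h𝒢 : ∀ G ∈ 𝒢, Disjoint G F) (i : Fin r) {f : MvPolynomial V k}
    (hf : linForm (L i) * f ∈ Ideal.span {f | ∃ G ∈ 𝒢, f = ∏ w ∈ G, X w} ⊔
      Ideal.span {f | ∃ q < i, f = linForm (L q)}) :
    f ∈ Ideal.span {f | ∃ G ∈ 𝒢, f = ∏ w ∈ G, X w} ⊔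
      Ideal.span {f | ∃ q < i, f = linForm (L q)} := by
  obtain ⟨φ, ψ, hφ, hψ, hφε, hψL, hφψ⟩ := exists_linear_substitution ε L hL
  set I₁ : Ideal (MvPolynomial V k) := Ideal.span {f | ∃ G ∈ 𝒢, f = ∏ w ∈ G, X w}
  set I₂ : Ideal (MvPolynomial V k) := Ideal.span {f | ∃ q < i, f = linForm (L q)}
  set I₃ : Ideal (MvPolynomial V k) :=
    Ideal.span ((X : V → MvPolynomial V k) '' {v | ∃ q < i, v = ε q})
  have hfix : ∀ χ : MvPolynomial V k →ₐ[k] MvPolynomial V k, (∀ w ∉ F, χ (X w) = X w) →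
      I₁ ≤ I₁.comap χ := by
    intro χ hχ
    refine Ideal.span_le.2 ?_
    rintro _ ⟨G, hG, rfl⟩
    refine Ideal.subset_span ⟨G, hG, ?_⟩
    rw [map_prod]
    exact Finset.prod_congr rfl fun w hw => hχ w (Finset.disjoint_left.1 (h𝒢 G hG) hw)
  have h1 : I₁ ⊔ I₂ ≤ (I₁ ⊔ I₃).comap ψ := by
    refine sup_le ((hfix ψ hψ).trans (Ideal.comap_mono le_sup_left)) (Ideal.span_le.2 ?_)
    rintro _ ⟨q, hq, rfl⟩
    refine Ideal.mem_sup_right (Ideal.subset_span ⟨ε q, ⟨q, hq, rfl⟩, (hψL q).symm⟩)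
  have h2 : I₁ ⊔ I₃ ≤ (I₁ ⊔ I₂).comap φ := by
    refine sup_le ((hfix φ hφ).trans (Ideal.comap_mono le_sup_left)) (Ideal.span_le.2 ?_)
    rintro _ ⟨_, ⟨q, hq, rfl⟩, rfl⟩
    refine Ideal.mem_sup_right (Ideal.subset_span ⟨q, hq, hφε q⟩)
  have h3 : X (ε i : V) * ψ f ∈ I₁ ⊔ I₃ := by
    rw [← hψL, ← map_mul]
    exact h1 hf
  have h4 := h2 (mem_of_X_mul_mem h𝒢 _ (ε i).2 (by
    rintro ⟨q, hq, h⟩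
    exact hq.ne (ε.injective (Subtype.ext h)).symm) h3)
  rwa [Ideal.mem_comap, hφψ] at h4

end LinearForms

section GenericSR

variable {k V : Type*} [Field k] [Fintype V] [LinearOrder V]
variable (Δ : PreAbstractSimplicialComplex V) {d : ℕ} (Θ : Fin d → V → k)

/-- The genericity condition on `Θ`: for every face `F` with `r` elements, the minor of `Θ` in the
first `r` rows and the columns of `F` does not vanish. -/
def FaceMinorsNonzero : Prop :=
  ∀ F ∈ Δ, ∃ h : F.card ≤ d,
    (Matrix.of fun i m => Θ (Fin.castLE h i) (F.orderEmbOfFin rfl m)).det ≠ 0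

variable {Δ Θ}

/-- Multiplication by `x_F`, for a face `F`, takes an ideal generated by squarefree monomials in the
variables outside `F`, which contains the Stanley–Reisner ideal, into the Stanley–Reisner ideal;
and modulo this larger ideal the first `#F` linear forms are a regular sequence. -/
theorem prod_X_mul_mem_paramIdeal {F : Finset V} (hF : F ∈ Δ) (hΘ : FaceMinorsNonzero Δ Θ)
    (s : Fin d) (hs : (s : ℕ) < F.card) {f : MvPolynomial V k}
    (hf : linForm (Θ s) * f ∈ paramIdeal Δ Θ s) :
    (∏ v ∈ F, X v) * f ∈ paramIdeal Δ Θ s := by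
  obtain ⟨hc, hdet⟩ := hΘ F hF
  set 𝒢 : Set (Finset V) := {G | Disjoint G F ∧ G ∪ F ∉ Δ}
  let ε : Fin F.card ≃ F := (F.orderIsoOfFin rfl).toEquiv
  set L : Fin F.card → V → k := fun i => Θ (Fin.castLE hc i)
  have hset : ({f | ∃ p : Fin d, (p : ℕ) < s ∧ f = linForm (Θ p)} : Set (MvPolynomial V k)) =
      {f | ∃ q < (⟨s, hs⟩ : Fin F.card), f = linForm (L q)} := by
    ext f
    constructor
    · rintro ⟨p, hp, rfl⟩
      exact ⟨⟨p, hp.trans hs⟩, hp, rfl⟩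
    · rintro ⟨q, hq, rfl⟩
      exact ⟨Fin.castLE hc q, hq, rfl⟩
  have hne : F.Nonempty := Finset.card_pos.1 (by omega)
  have h1 : stanleyReisnerIdeal k Δ ≤ Ideal.span {f | ∃ G ∈ 𝒢, f = ∏ w ∈ G, X w} := by
    refine Ideal.span_le.2 ?_
    rintro _ ⟨H, hH, hHΔ, rfl⟩
    refine Ideal.mem_of_dvd _ (Finset.prod_dvd_prod_of_subset _ _ _ (Finset.sdiff_subset (t := F)))
      (Ideal.subset_span ⟨H \ F, ⟨Finset.sdiff_disjoint, fun h => hHΔ ?_⟩, rfl⟩)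
    rw [Finset.sdiff_union_self_eq_union] at h
    exact (Δ.isRelLowerSet_faces h).2 Finset.subset_union_left hH
  have h2 : ∀ g ∈ Ideal.span {f : MvPolynomial V k | ∃ G ∈ 𝒢, f = ∏ w ∈ G, X w},
      (∏ v ∈ F, X v) * g ∈ stanleyReisnerIdeal k Δ := by
    intro g hg
    refine (Submodule.span_le (p := Submodule.comap
      (LinearMap.mulLeft (MvPolynomial V k) (∏ v ∈ F, X v)) (stanleyReisnerIdeal k Δ))).2 ?_ hg
    rintro _ ⟨G, ⟨hGF, hG⟩, rfl⟩
    change (∏ v ∈ F, X v) * (∏ w ∈ G, X w) ∈ stanleyReisnerIdeal k Δ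
    rw [mul_comm, ← Finset.prod_union hGF]
    exact Ideal.subset_span ⟨_, hne.mono Finset.subset_union_right, hG, rfl⟩
  have h3 := mem_of_linForm_mul_mem ε L hdet (𝒢 := 𝒢) (fun G hG => hG.1) ⟨s, hs⟩ (f := f)
    (by
      rw [← hset]
      exact sup_le_sup_right h1 _ hf)
  rw [← hset] at h3
  obtain ⟨g, hg, g', hg', rfl⟩ := Submodule.mem_sup.1 h3
  rw [mul_add]
  exact Ideal.add_mem _ (Ideal.mem_sup_left (h2 g hg))
    (Ideal.mem_sup_right (Ideal.mul_mem_left _ _ hg'))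

/-- The common core of the two consequences of genericity. By downward induction on `F`, a power of
`x_F` lies in `K`: for a face `F` with at most `s` elements, the minor of `F` allows to write the
variables of `F` in terms of `θ_1, …, θ_s`, which lie in `K`, and the variables `x_w` with `w ∉ F`,
and `x_w x_F = x_{F ∪ w}`. -/
theorem prod_X_mem_radical (hΘ : FaceMinorsNonzero Δ Θ) (s : ℕ)
    {K : Ideal (MvPolynomial V k)} (hK : paramIdeal Δ Θ s ≤ K)
    (hsmall : ∀ F ∈ Δ, s < F.card → ∏ v ∈ F, X v ∈ K)
    (F : Finset V) (hF : F.Nonempty) : (∏ v ∈ F, X v : MvPolynomial V k) ∈ K.radical := by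
  induction hn : Fintype.card V - F.card using Nat.strong_induction_on generalizing F with
  | _ n ih =>
    by_cases hFΔ : F ∈ Δ
    swap
    · exact Ideal.le_radical (hK (Ideal.mem_sup_left (Ideal.subset_span ⟨F, hF, hFΔ, rfl⟩)))
    by_cases hs : s < F.card
    · exact Ideal.le_radical (hsmall F hFΔ hs)
    obtain ⟨hc, hdet⟩ := hΘ F hFΔ
    obtain ⟨a, -, ha⟩ := exists_X_eq_sum_linForm (F.orderIsoOfFin rfl).toEquiv
      (fun i => Θ (Fin.castLE hc i)) hdet
    set m₀ : Fin F.card := ⟨0, hF.card_pos⟩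
    set v₀ : V := ((F.orderIsoOfFin rfl).toEquiv m₀).1
    have hv₀ : v₀ ∈ F := Subtype.coe_prop _
    set R := K.radical
    have hX : X v₀ * (∏ v ∈ F, X v : MvPolynomial V k) ∈ R := by
      rw [ha m₀, Finset.sum_mul]
      refine Ideal.sum_mem _ fun i _ => ?_
      rw [mul_assoc, sub_mul]
      refine Ideal.mul_mem_left _ _ (Ideal.sub_mem _ ?_ ?_)
      · refine Ideal.mul_mem_right _ _ (Ideal.le_radical (hK (Ideal.mem_sup_right
          (Ideal.subset_span ⟨_, ?_, rfl⟩))))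
        exact lt_of_lt_of_le i.2 (not_lt.1 hs)
      · rw [Finset.sum_mul]
        refine Ideal.sum_mem _ fun w hw => ?_
        have hwF : w ∉ F := by simpa using hw
        rw [mul_assoc, ← Finset.prod_insert hwF]
        refine Ideal.mul_mem_left _ _ (ih _ ?_ (insert w F) (Finset.insert_nonempty _ _) rfl)
        have h1 : (insert w F).card ≤ Fintype.card V := Finset.card_le_univ _
        rw [Finset.card_insert_of_notMem hwF] at h1 ⊢
        omega
    -- `x_F ^ 2 = (x_{v₀} x_F) x_{F ∖ v₀}`
    have hsq : (∏ v ∈ F, X v : MvPolynomial V k) ^ 2 ∈ R := by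
      rw [sq]
      nth_rewrite 1 [← Finset.mul_prod_erase F _ hv₀]
      rw [mul_right_comm]
      exact Ideal.mul_mem_right _ _ hX
    exact Ideal.radical_isRadical K ⟨2, hsq⟩

/-- For generic `Θ` the sequence `θ_1, …, θ_d` is filter-regular on the Stanley–Reisner ring: the
kernel of `θ_{s+1}` on `k[Δ] / (θ_1, …, θ_s)` is killed by powers of the variables. -/
theorem exists_pow_mul_mem_paramIdeal (hΘ : FaceMinorsNonzero Δ Θ) (s : Fin d)
    {f : MvPolynomial V k} (hf : linForm (Θ s) * f ∈ paramIdeal Δ Θ s) (v : V) :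
    ∃ n : ℕ, X v ^ n * f ∈ paramIdeal Δ Θ s := by
  have h := prod_X_mem_radical hΘ s
    (K := Submodule.comap (LinearMap.toSpanSingleton _ _ f) (paramIdeal Δ Θ s))
    (fun g hg => Ideal.mul_mem_right _ _ hg)
    (fun F hF hs => prod_X_mul_mem_paramIdeal hF hΘ s hs hf) {v} (Finset.singleton_nonempty v)
  rw [Finset.prod_singleton] at h
  exact h

theorem isLSOP_of_faceMinorsNonzero (hΘ : FaceMinorsNonzero Δ Θ) : IsLSOP Δ Θ := by
  have h : ∀ v, IsIntegral k (Ideal.Quotient.mkₐ k (paramIdeal Δ Θ d) (X v)) := by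
    intro v
    have h := prod_X_mem_radical hΘ d le_rfl
      (fun F hF hs => absurd hs (not_lt.2 (hΘ F hF).1)) {v} (Finset.singleton_nonempty v)
    rw [Finset.prod_singleton] at h
    obtain ⟨n, hn⟩ := h
    have hz : (Ideal.Quotient.mkₐ k (paramIdeal Δ Θ d) (X v)) ^ n = 0 := by
      rw [← map_pow]
      exact Ideal.Quotient.eq_zero_iff_mem.2 hn
    refine ⟨Polynomial.X ^ n, Polynomial.monic_X_pow n, ?_⟩
    simp only [Polynomial.eval₂_X_pow, hz]
  have hint : Algebra.IsIntegral k (MvPolynomial V k ⧸ paramIdeal Δ Θ d) := by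
    refine ⟨fun x => ?_⟩
    obtain ⟨f, rfl⟩ := Ideal.Quotient.mkₐ_surjective k _ x
    induction f using MvPolynomial.induction_on with
    | C a => exact isIntegral_algebraMap (x := a)
    | add p q hp hq => rw [map_add]; exact hp.add hq
    | mul_X p v hp => rw [map_mul]; exact hp.mul (h v)
  exact Algebra.IsIntegral.finite (R := k) (A := MvPolynomial V k ⧸ paramIdeal Δ Θ d)

/-- The condition `FaceMinorsNonzero` defines a nonempty Zariski open set: it is the nonvanishing
of the product of the minors of the generic matrix. -/
theorem exists_eval_ne_zero_faceMinorsNonzero (k : Type*) [Field k]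
    (Δ : PreAbstractSimplicialComplex V) (d : ℕ) (hd : ∀ F ∈ Δ, F.card ≤ d) :
    ∃ P : MvPolynomial (Fin d × V) k, P ≠ 0 ∧ ∀ Θ : Fin d → V → k,
      MvPolynomial.eval (fun q => Θ q.1 q.2) P ≠ 0 → FaceMinorsNonzero Δ Θ := by
  classical
  let minor (F : Finset V) : MvPolynomial (Fin d × V) k := if h : F ∈ Δ then
    (Matrix.of fun i m => (X (Fin.castLE (hd F h) i, F.orderEmbOfFin rfl m) :
      MvPolynomial (Fin d × V) k)).det else 1
  have hminor : ∀ F (h : F ∈ Δ) (Θ : Fin d → V → k),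
      MvPolynomial.eval (fun q => Θ q.1 q.2) (minor F) = (Matrix.of fun i m =>
        Θ (Fin.castLE (hd F h) i) (F.orderEmbOfFin rfl m)).det := by
    intro F h Θ
    simp only [minor, dif_pos h]
    rw [RingHom.map_det]
    congr 1
    ext i m
    simp
  refine ⟨∏ F, minor F, Finset.prod_ne_zero_iff.2 fun F _ hF0 => ?_, fun Θ hΘ F hF => ?_⟩
  · by_cases hF : F ∈ Δ
    · have h := hminor F hF fun i v => if ∃ m : Fin F.card, (m : ℕ) = i ∧ F.orderEmbOfFin rfl m = v
        then 1 else 0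
      have h1 : (Matrix.of fun i m => if ∃ m' : Fin F.card,
          (m' : ℕ) = (Fin.castLE (hd F hF) i : Fin d) ∧
            F.orderEmbOfFin rfl m' = F.orderEmbOfFin rfl m then (1 : k) else 0) =
          (1 : Matrix (Fin F.card) (Fin F.card) k) := by
        ext i m
        rw [Matrix.of_apply, Matrix.one_apply]
        refine if_congr ?_ rfl rfl
        constructor
        · rintro ⟨m', h1, h2⟩
          rw [← (F.orderEmbOfFin rfl).injective h2]
          exact Fin.ext h1.symm
        · rintro rfl
          exact ⟨i, rfl, rfl⟩
      rw [h1, hF0, Matrix.det_one, map_zero] at h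
      exact zero_ne_one h
    · simp only [minor, dif_neg hF] at hF0
      exact one_ne_zero hF0
  · rw [map_prod, Finset.prod_ne_zero_iff] at hΘ
    exact ⟨hd F hF, by rw [← hminor F hF]; exact hΘ F (Finset.mem_univ F)⟩

end GenericSR

/-! ### Gradings as families of projections, and their extension to the Čech complex -/

/-- A grading of the `A`-module `M` by a group `G`, for the grading of `A` in which `x_v` has degree
`w v`, recorded by the projections `p g` onto the homogeneous components. The cases in use are
`G = ℤ` with `w = 1`, and the fine grading `G = V → ℤ` with `w v` the `v`-th unit vector. -/
structure GradingProj {k V G : Type*} [Field k] [AddCommGroup G] (w : V → G) (M : Type*)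
    [AddCommGroup M] [Module k M] [Module (MvPolynomial V k) M] where
  /-- The projection onto the component of degree `g`. -/
  p : G → M →ₗ[k] M
  X_smul : ∀ g v m, p (g + w v) ((X v : MvPolynomial V k) • m) = (X v : MvPolynomial V k) • p g m
  idem : ∀ g m, p g (p g m) = p g m
  orth : ∀ g h m, g ≠ h → p g (p h m) = 0
  exists_sum : ∀ m, ∃ T : Finset G, ∑ g ∈ T, p g m = m

section CechBasics

variable {k V : Type*} [Field k] {M : Type*} [AddCommGroup M] [Module (MvPolynomial V k) M]

/-- The restriction `M_{x_S} → M_{x_T}` for `S ⊆ T`. -/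
def res {S T : Finset V} (h : S ⊆ T) : Loc k M S →ₗ[MvPolynomial V k] Loc k M T :=
  LocalizedModule.liftOfLE (monomialsOn k S) (monomialsOn k T) (monomialsOn_mono k h)

theorem res_mk {S T : Finset V} (h : S ⊆ T) (m : M) (s : monomialsOn k S) :
    res h (LocalizedModule.mk m s) =
      LocalizedModule.mk m (⟨s, monomialsOn_mono k h s.2⟩ : monomialsOn k T) := by
  rw [res, IsLocalizedModule.mk_eq_mk', IsLocalizedModule.liftOfLE_mk',
    IsLocalizedModule.mk_eq_mk']

theorem mk_add_mk_same {S : Finset V} (m m' : M) (s : monomialsOn k S) :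
    (LocalizedModule.mk m s + LocalizedModule.mk m' s : Loc k M S) =
      LocalizedModule.mk (m + m') s := by
  rw [LocalizedModule.mk_add_mk, ← smul_add, LocalizedModule.mk_cancel_common_left]

theorem mem_cochains {p : ℕ} {c : Cech (V := V) k M} :
    c ∈ cochains k M p ↔ ∀ S : Finset V, S.card ≠ p → c S = 0 := by
  simp only [cochains, Submodule.mem_iInf, LinearMap.mem_ker, LinearMap.proj_apply]

variable [LinearOrder V]

theorem cechD_apply (c : Cech (V := V) k M) (T : Finset V) :
    cechD k M c T = ∑ v ∈ T, (-1 : MvPolynomial V k) ^ (T.filter (· < v)).card •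
      res (T.erase_subset v) (c (T.erase v)) := by
  rw [cechD, LinearMap.pi_apply, LinearMap.sum_apply]
  rfl

theorem cls_surjective (p : ℕ) : Function.Surjective (cls (V := V) (k := k) (M := M) p) :=
  Submodule.mkQ_surjective _

theorem cls_eq_zero {p : ℕ} {u : cocycles (V := V) k M p} :
    cls p u = 0 ↔ (u : Cech (V := V) k M) ∈ coboundaries k M p := by
  rw [cls, Submodule.mkQ_apply, Submodule.Quotient.mk_eq_zero]
  rfl

end CechBasics

section Weight

variable {k V G : Type*} [Field k] [AddCommGroup G] (w : V → G)

/-- The weight of a monomial (for a general polynomial, the sum of the weights of its terms). -/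
def monWeight (f : MvPolynomial V k) : G := ∑ a ∈ f.support, Finsupp.weight w a

@[simp] theorem monWeight_monomial (a : V →₀ ℕ) :
    monWeight w (monomial a (1 : k)) = Finsupp.weight w a := by
  classical
  rw [monWeight, support_monomial, if_neg one_ne_zero, Finset.sum_singleton]

theorem exists_eq_monomial {S : Finset V} {s : MvPolynomial V k} (hs : s ∈ monomialsOn k S) :
    ∃ a : V →₀ ℕ, (∀ v ∉ S, a v = 0) ∧ s = monomial a 1 := by
  classical
  induction hs using Submonoid.closure_induction with
  | mem x hx =>
    obtain ⟨v, hv, rfl⟩ := hx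
    refine ⟨Finsupp.single v 1, fun u hu => Finsupp.single_eq_of_ne ?_, rfl⟩
    rintro rfl
    exact hu hv
  | one => exact ⟨0, fun _ _ => rfl, rfl⟩
  | mul x y _ _ hx hy =>
    obtain ⟨a, ha, rfl⟩ := hx
    obtain ⟨b, hb, rfl⟩ := hy
    exact ⟨a + b, fun v hv => by rw [Finsupp.add_apply, ha v hv, hb v hv],
      by rw [monomial_mul, one_mul]⟩

theorem monomial_mem_monomialsOn {S : Finset V} {a : V →₀ ℕ} (ha : ∀ v ∉ S, a v = 0) :
    monomial a (1 : k) ∈ monomialsOn k S := by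
  rw [monomial_eq, C_1, one_mul]
  refine Submonoid.prod_mem _ fun v hv => Submonoid.pow_mem _ (Submonoid.subset_closure ?_) _
  refine ⟨v, ?_, rfl⟩
  by_contra h
  exact (Finsupp.mem_support_iff.1 hv) (ha v h)

theorem monWeight_mul {S : Finset V} (s t : monomialsOn k S) :
    monWeight w ((s * t : monomialsOn k S) : MvPolynomial V k) =
      monWeight w (s : MvPolynomial V k) + monWeight w (t : MvPolynomial V k) := by
  obtain ⟨a, -, ha⟩ := exists_eq_monomial s.2
  obtain ⟨b, -, hb⟩ := exists_eq_monomial t.2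
  rw [Submonoid.coe_mul, ha, hb, monomial_mul, one_mul]
  simp

end Weight

namespace GradingProj

variable {k V G : Type*} [Field k] [AddCommGroup G] {w : V → G}
variable {M : Type*} [AddCommGroup M] [Module k M] [Module (MvPolynomial V k) M]
variable (D : GradingProj (k := k) w M)

theorem monomial_smul (a : V →₀ ℕ) (g : G) (m : M) :
    D.p (g + Finsupp.weight w a) (monomial a (1 : k) • m) = monomial a (1 : k) • D.p g m := by
  induction a using Finsupp.induction_linear generalizing g m with
  | zero =>
    have : (monomial (0 : V →₀ ℕ) (1 : k)) = 1 := rfl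
    rw [this, one_smul, one_smul, map_zero, add_zero]
  | add a b ha hb =>
    have : monomial (a + b) (1 : k) = monomial b 1 * monomial a 1 := by
      rw [monomial_mul, one_mul, add_comm]
    rw [this, mul_smul, mul_smul, map_add, ← add_assoc, hb, ha]
  | single v n =>
    induction n with
    | zero =>
      have : (monomial (0 : V →₀ ℕ) (1 : k)) = 1 := rfl
      rw [Finsupp.single_zero, this, one_smul, one_smul, map_zero, add_zero]
    | succ n ih =>
      have : monomial (Finsupp.single v (n + 1)) (1 : k) = X v * monomial (Finsupp.single v n) 1 := by
        rw [X, monomial_mul, one_mul, add_comm, Finsupp.single_add]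
      have hw : Finsupp.weight w (Finsupp.single v (n + 1)) =
          Finsupp.weight w (Finsupp.single v n) + w v := by
        rw [Finsupp.single_add, map_add, Finsupp.weight_single, Finsupp.weight_single, one_smul]
      rw [this, mul_smul, mul_smul, hw, ← add_assoc, D.X_smul, ih]

theorem smul_mem {S : Finset V} (s : monomialsOn k S) (g : G) (m : M) :
    D.p (g + monWeight w (s : MvPolynomial V k)) (s • m) = s • D.p g m := by
  obtain ⟨a, -, ha⟩ := exists_eq_monomial s.2
  rw [Submonoid.smul_def, Submonoid.smul_def, ha, monWeight_monomial, monomial_smul]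

variable [IsScalarTower k (MvPolynomial V k) M]

theorem mk_k_smul (S : Finset V) (c : k) (m : M) (s : monomialsOn k S) :
    c • (LocalizedModule.mk m s : Loc k M S) = LocalizedModule.mk (c • m) s := by
  rw [← algebraMap_smul (MvPolynomial V k) c (LocalizedModule.mk m s), LocalizedModule.smul'_mk,
    algebraMap_smul]

/-- The projection onto the component of degree `g` of `M_{x_S}`:
`m / s ↦ p_{g + deg s} m / s`. -/
def loc (S : Finset V) (g : G) : Loc k M S →ₗ[k] Loc k M S where
  toFun x := LocalizedModule.liftOn x
    (fun a => LocalizedModule.mk (D.p (g + monWeight w (a.2 : MvPolynomial V k)) a.1) a.2) (by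
      rintro ⟨m, s⟩ ⟨m', s'⟩ ⟨u, hu⟩
      refine LocalizedModule.mk_eq.2 ⟨u, ?_⟩
      have h := congrArg (D.p (g + monWeight w (s : MvPolynomial V k) +
        monWeight w (s' : MvPolynomial V k) + monWeight w (u : MvPolynomial V k))) hu
      dsimp only at h ⊢
      rw [D.smul_mem, D.smul_mem, D.smul_mem] at h
      rw [h, add_right_comm g, D.smul_mem])
  map_add' x y := by
    induction x, y using LocalizedModule.induction_on₂ with
    | _ m m' s s' =>
      simp only [LocalizedModule.mk_add_mk, LocalizedModule.liftOn_mk, map_add, monWeight_mul]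
      rw [← add_assoc, D.smul_mem, add_right_comm, D.smul_mem]
  map_smul' c x := by
    induction x using LocalizedModule.induction_on with
    | _ m s =>
      simp only [mk_k_smul, LocalizedModule.liftOn_mk, map_smul, RingHom.id_apply]

theorem loc_mk (S : Finset V) (g : G) (m : M) (s : monomialsOn k S) :
    D.loc S g (LocalizedModule.mk m s) =
      LocalizedModule.mk (D.p (g + monWeight w (s : MvPolynomial V k)) m) s := rfl

theorem loc_idem (S : Finset V) (g : G) (x : Loc k M S) :
    D.loc S g (D.loc S g x) = D.loc S g x := by
  induction x using LocalizedModule.induction_on with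
  | _ m s => rw [loc_mk, loc_mk, D.idem]

theorem loc_orth (S : Finset V) (g h : G) (x : Loc k M S) (hgh : g ≠ h) :
    D.loc S g (D.loc S h x) = 0 := by
  induction x using LocalizedModule.induction_on with
  | _ m s =>
    rw [loc_mk, loc_mk, D.orth _ _ _ (fun e => hgh (add_right_cancel e)), LocalizedModule.zero_mk]

theorem loc_X_smul (S : Finset V) (g : G) (v : V) (x : Loc k M S) :
    D.loc S (g + w v) ((X v : MvPolynomial V k) • x) = (X v : MvPolynomial V k) • D.loc S g x := by
  induction x using LocalizedModule.induction_on with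
  | _ m s => rw [LocalizedModule.smul'_mk, loc_mk, loc_mk, LocalizedModule.smul'_mk, add_right_comm,
      D.X_smul]

theorem loc_exists_sum (S : Finset V) (x : Loc k M S) :
    ∃ T : Finset G, ∑ g ∈ T, D.loc S g x = x := by
  classical
  induction x using LocalizedModule.induction_on with
  | _ m s =>
    obtain ⟨T, hT⟩ := D.exists_sum m
    refine ⟨T.image fun g => g - monWeight w (s : MvPolynomial V k), ?_⟩
    rw [Finset.sum_image (by intro a _ b _ h; exact sub_left_injective h)]
    simp_rw [loc_mk, sub_add_cancel]
    have h : ∀ T : Finset G, ∑ g ∈ T, (LocalizedModule.mk (D.p g m) s : Loc k M S) =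
        LocalizedModule.mk (∑ g ∈ T, D.p g m) s := by
      intro T
      induction T using Finset.induction_on with
      | empty => simp
      | insert a T ha ih =>
        rw [Finset.sum_insert ha, Finset.sum_insert ha, ih, mk_add_mk_same]
    rw [h, hT]

theorem loc_sum_of_subset {S : Finset V} {x : Loc k M S} {T T' : Finset G}
    (hT : ∑ g ∈ T, D.loc S g x = x) (h : T ⊆ T') : ∑ g ∈ T', D.loc S g x = x := by
  rw [← Finset.sum_subset h, hT]
  intro g _ hg
  rw [← hT, map_sum]
  refine Finset.sum_eq_zero fun h hh => D.loc_orth _ _ _ _ ?_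
  rintro rfl
  exact hg hh

theorem loc_res {S T : Finset V} (hST : S ⊆ T) (g : G) (x : Loc k M S) :
    D.loc T g (res hST x) = res hST (D.loc S g x) := by
  induction x using LocalizedModule.induction_on with
  | _ m s => rw [loc_mk, res_mk, res_mk, loc_mk]

theorem loc_neg_one_pow_smul (S : Finset V) (g : G) (n : ℕ) (x : Loc k M S) :
    D.loc S g ((-1 : MvPolynomial V k) ^ n • x) = (-1 : MvPolynomial V k) ^ n • D.loc S g x := by
  rcases neg_one_pow_eq_or (MvPolynomial V k) n with h | h <;> simp [h]

theorem C_smul (g : G) (c : k) (m : M) :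
    D.p g ((C c : MvPolynomial V k) • m) = (C c : MvPolynomial V k) • D.p g m := by
  rw [← algebraMap_eq, algebraMap_smul, algebraMap_smul, map_smul]

/-- The projection of Čech cochains onto the component of degree `g`. -/
def cech (g : G) : Cech (V := V) k M →ₗ[k] Cech (V := V) k M :=
  LinearMap.pi fun S => D.loc S g ∘ₗ LinearMap.proj S

theorem cech_apply (g : G) (c : Cech (V := V) k M) (S : Finset V) :
    D.cech g c S = D.loc S g (c S) := rfl

theorem cech_mem_cochains (g : G) {p : ℕ} {c : Cech (V := V) k M} (hc : c ∈ cochains k M p) :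
    D.cech g c ∈ cochains k M p := by
  rw [mem_cochains] at hc ⊢
  intro S hS
  rw [cech_apply, hc S hS, map_zero]

theorem cech_X_smul (g : G) (v : V) (c : Cech (V := V) k M) :
    D.cech (g + w v) ((X v : MvPolynomial V k) • c) = (X v : MvPolynomial V k) • D.cech g c := by
  funext S
  exact D.loc_X_smul S g v (c S)

theorem cech_idem (g : G) (c : Cech (V := V) k M) : D.cech g (D.cech g c) = D.cech g c := by
  funext S
  exact D.loc_idem S g (c S)

theorem cech_orth (g h : G) (c : Cech (V := V) k M) (hgh : g ≠ h) :
    D.cech g (D.cech h c) = 0 := by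
  funext S
  exact D.loc_orth S g h (c S) hgh

theorem cech_exists_sum [Fintype V] (c : Cech (V := V) k M) :
    ∃ T : Finset G, ∑ g ∈ T, D.cech g c = c := by
  classical
  choose T hT using fun S => D.loc_exists_sum S (c S)
  refine ⟨Finset.univ.biUnion T, funext fun S => ?_⟩
  rw [Finset.sum_apply]
  exact D.loc_sum_of_subset (hT S) (Finset.subset_biUnion_of_mem T (Finset.mem_univ S))

variable [LinearOrder V]

theorem cechD_cech (g : G) (c : Cech (V := V) k M) :
    cechD k M (D.cech g c) = D.cech g (cechD k M c) := by
  funext T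
  rw [cech_apply, cechD_apply, cechD_apply, map_sum]
  refine Finset.sum_congr rfl fun v _ => ?_
  rw [loc_neg_one_pow_smul, loc_res, cech_apply]

theorem cech_mem_cocycles (g : G) {p : ℕ} {c : Cech (V := V) k M} (hc : c ∈ cocycles k M p) :
    D.cech g c ∈ cocycles k M p :=
  ⟨D.cech_mem_cochains g hc.1, LinearMap.mem_ker.2 (by
    rw [cechD_cech, LinearMap.mem_ker.1 hc.2, map_zero])⟩

theorem cech_mem_coboundaries (g : G) {p : ℕ} {c : Cech (V := V) k M}
    (hc : c ∈ coboundaries k M p) : D.cech g c ∈ coboundaries k M p := by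
  cases p with
  | zero =>
    rw [(Submodule.mem_bot _).1 hc, map_zero]
    exact Submodule.zero_mem _
  | succ p =>
    obtain ⟨b, hb, rfl⟩ := hc
    exact ⟨_, D.cech_mem_cochains g hb, D.cechD_cech g b⟩

/-- The projection of cocycles onto the component of degree `g`. -/
def cocyc (p : ℕ) (g : G) : cocycles (V := V) k M p →ₗ[k] cocycles (V := V) k M p where
  toFun u := ⟨D.cech g u, D.cech_mem_cocycles g u.2⟩
  map_add' _ _ := Subtype.ext (map_add (D.cech g) _ _)
  map_smul' c _ := Subtype.ext (map_smul (D.cech g) c _)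

/-- The projection of local cohomology onto the component of degree `g`. -/
def cohProj (p : ℕ) (g : G) : LocalCoh (V := V) k M p →ₗ[k] LocalCoh (V := V) k M p where
  toFun := QuotientAddGroup.map _ _ (D.cocyc p g).toAddMonoidHom
    fun _ hu => D.cech_mem_coboundaries g hu
  map_add' := map_add _
  map_smul' c x := by
    obtain ⟨u, rfl⟩ := cls_surjective p x
    exact congrArg (cls p) ((D.cocyc p g).map_smul c u)

theorem cohProj_cls (p : ℕ) (g : G) (u : cocycles (V := V) k M p) :
    D.cohProj p g (cls p u) = cls p (D.cocyc p g u) := rfl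

/-- The grading of local cohomology induced by a grading of `M`. -/
def coh [Fintype V] (p : ℕ) : GradingProj (k := k) w (LocalCoh (V := V) k M p) where
  p := D.cohProj p
  X_smul g v x := by
    obtain ⟨u, rfl⟩ := cls_surjective p x
    rw [← map_smul, cohProj_cls, cohProj_cls, ← map_smul]
    exact congrArg (cls p) (Subtype.ext (D.cech_X_smul g v u))
  idem g x := by
    obtain ⟨u, rfl⟩ := cls_surjective p x
    rw [cohProj_cls, cohProj_cls]
    exact congrArg (cls p) (Subtype.ext (D.cech_idem g u))
  orth g h x hgh := by
    obtain ⟨u, rfl⟩ := cls_surjective p x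
    rw [cohProj_cls, cohProj_cls,
      show D.cocyc p g (D.cocyc p h u) = 0 from Subtype.ext (D.cech_orth g h u hgh), map_zero]
  exists_sum x := by
    obtain ⟨u, rfl⟩ := cls_surjective p x
    obtain ⟨T, hT⟩ := D.cech_exists_sum (u : Cech (V := V) k M)
    refine ⟨T, ?_⟩
    have h : ∑ g ∈ T, D.cocyc p g u = u := by
      refine Subtype.ext ?_
      rw [AddSubmonoidClass.coe_finsetSum]
      exact hT
    simp_rw [cohProj_cls]
    rw [← map_sum, h]

end GradingProj

/-! ### The standard grading and gradings of cyclic modules -/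

namespace GradingProj

section Standard

variable {k V : Type*} [Field k]
variable {M : Type*} [AddCommGroup M] [Module k M] [Module (MvPolynomial V k) M]
variable [IsScalarTower k (MvPolynomial V k) M]

theorem linForm_smul [Fintype V] (D : GradingProj (k := k) (V := V) (fun _ => (1 : ℤ)) M) (n : ℤ)
    (a : V → k) (m : M) : D.p (n + 1) (linForm a • m) = linForm a • D.p n m := by
  rw [linForm, Finset.sum_smul, Finset.sum_smul, map_sum]
  refine Finset.sum_congr rfl fun v _ => ?_
  rw [mul_smul, mul_smul, D.C_smul, D.X_smul]

variable (D : GradingProj (k := k) (V := V) (fun _ => (1 : ℤ)) M)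

theorem weight_one_eq (a : V →₀ ℕ) : Finsupp.weight (fun _ : V => (1 : ℤ)) a = (a.degree : ℤ) := by
  rw [Finsupp.weight_apply, Finsupp.degree_apply]
  simp [Finsupp.sum]

theorem monWeight_eq_of_isHomogeneous {S : Finset V} (s : monomialsOn k S) {e : ℕ} :
    (s : MvPolynomial V k).IsHomogeneous e ↔
      monWeight (fun _ => (1 : ℤ)) (s : MvPolynomial V k) = e := by
  obtain ⟨a, -, ha⟩ := exists_eq_monomial s.2
  rw [ha, monWeight_monomial, weight_one_eq]
  constructor
  · intro h
    classical
    rw [← h (d := a) (by rw [coeff_monomial, if_pos rfl]; exact one_ne_zero),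
      Finsupp.degree_eq_weight_one]
    rfl
  · intro h
    exact isHomogeneous_monomial _ (by exact_mod_cast h)

theorem mem_locDeg {𝓜 : ℤ → Submodule k M} (h𝓜 : ∀ n m, m ∈ 𝓜 n ↔ D.p n m = m) (S : Finset V)
    (n : ℤ) (x : Loc k M S) : x ∈ locDeg 𝓜 S n ↔ D.loc S n x = x := by
  constructor
  · intro hx
    induction hx using Submodule.span_induction with
    | mem x hx =>
      obtain ⟨e, m, s, hs, hm, rfl⟩ := hx
      rw [D.loc_mk, (monWeight_eq_of_isHomogeneous s).1 hs, (h𝓜 _ _).1 hm]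
    | zero => rw [map_zero]
    | add x y _ _ hx hy => rw [map_add, hx, hy]
    | smul c x _ hx => rw [map_smul, hx]
  · intro hx
    induction x using LocalizedModule.induction_on with
    | _ m s =>
      obtain ⟨a, -, ha⟩ := exists_eq_monomial s.2
      rw [← hx, D.loc_mk]
      refine Submodule.subset_span ⟨a.degree, _, s, ?_, ?_, rfl⟩
      · rw [ha]
        exact isHomogeneous_monomial _ rfl
      · rw [h𝓜, ha, monWeight_monomial, weight_one_eq, D.idem]

theorem mem_cohDeg [Fintype V] [LinearOrder V] {𝓜 : ℤ → Submodule k M}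
    (h𝓜 : ∀ n m, m ∈ 𝓜 n ↔ D.p n m = m) (p : ℕ) (n : ℤ) (x : LocalCoh (V := V) k M p) :
    x ∈ cohDeg 𝓜 p n ↔ (D.coh p).p n x = x := by
  constructor
  · rintro ⟨u, hu, rfl⟩
    have : D.cocyc p n u = u := by
      refine Subtype.ext (funext fun S => ?_)
      exact (D.mem_locDeg h𝓜 S n _).1 (hu S (Set.mem_univ S))
    exact (D.cohProj_cls p n u).trans (congrArg (cls p) this)
  · intro hx
    obtain ⟨u, rfl⟩ := cls_surjective p x
    rw [← hx]
    refine ⟨D.cocyc p n u, fun S _ => ?_, rfl⟩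
    exact (D.mem_locDeg h𝓜 S n _).2 (D.loc_idem S n _)

end Standard

section Quotient

variable {k V G : Type*} [Field k] [AddCommGroup G]

theorem weightedHomogeneousComponent_mul (w : V → G) {f : MvPolynomial V k} {h : G}
    (hf : IsWeightedHomogeneous w f h) (g : G) (r : MvPolynomial V k) :
    weightedHomogeneousComponent w g (r * f) = weightedHomogeneousComponent w (g - h) r * f := by
  induction r using MvPolynomial.induction_on' with
  | monomial a c =>
    have h1 : IsWeightedHomogeneous w (monomial a c) (Finsupp.weight w a) :=
      isWeightedHomogeneous_monomial w a c rfl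
    by_cases hg : g = Finsupp.weight w a + h
    · rw [hg, (h1.mul hf).weightedHomogeneousComponent_same, add_sub_cancel_right,
        h1.weightedHomogeneousComponent_same]
    · rw [(h1.mul hf).weightedHomogeneousComponent_ne _ hg,
        h1.weightedHomogeneousComponent_ne _ (fun e => hg (sub_eq_iff_eq_add.1 e)), zero_mul]
  | add p q hp hq => rw [add_mul, map_add, hp, hq, map_add, add_mul]

theorem weightedHomogeneousComponent_mem_span (w : V → G) (S : Set (MvPolynomial V k))
    (hS : ∀ f ∈ S, ∃ h, IsWeightedHomogeneous w f h) (g : G) (f : MvPolynomial V k)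
    (hf : f ∈ Ideal.span S) : weightedHomogeneousComponent w g f ∈ Ideal.span S := by
  induction hf using Submodule.span_induction generalizing g with
  | mem x hx =>
    obtain ⟨h, hh⟩ := hS x hx
    rw [← one_mul x, weightedHomogeneousComponent_mul w hh]
    exact Ideal.mul_mem_left _ _ (Ideal.subset_span hx)
  | zero => rw [map_zero]; exact Ideal.zero_mem _
  | add x y _ _ hx hy => rw [map_add]; exact Ideal.add_mem _ (hx g) (hy g)
  | smul r x _ hx =>
    -- decompose the coefficient into monomials
    rw [smul_eq_mul]
    induction r using MvPolynomial.induction_on' with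
    | monomial a c =>
      have h1 : IsWeightedHomogeneous w (monomial a c) (Finsupp.weight w a) :=
        isWeightedHomogeneous_monomial w a c rfl
      rw [mul_comm, weightedHomogeneousComponent_mul w h1]
      exact Ideal.mul_mem_right _ _ (hx _)
    | add p q hp hq => rw [add_mul, map_add]; exact Ideal.add_mem _ hp hq

/-- The grading of `A ⧸ J` for a homogeneous ideal `J`. -/
def quotient (w : V → G) (J : Ideal (MvPolynomial V k))
    (hJ : ∀ g, ∀ f ∈ J, weightedHomogeneousComponent w g f ∈ J) :
    GradingProj (k := k) w (MvPolynomial V k ⧸ J) where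
  p g :=
    { toFun := QuotientAddGroup.map _ _ (weightedHomogeneousComponent w g).toAddMonoidHom (hJ g)
      map_add' := map_add _
      map_smul' := by
        intro c x
        obtain ⟨f, rfl⟩ := Ideal.Quotient.mk_surjective x
        exact congrArg (Ideal.Quotient.mk J) ((weightedHomogeneousComponent w g).map_smul c f) }
  X_smul g v x := by
    obtain ⟨f, rfl⟩ := Ideal.Quotient.mk_surjective x
    refine congrArg (Ideal.Quotient.mk J) (?_ : weightedHomogeneousComponent w (g + w v) (X v * f) =
      X v * weightedHomogeneousComponent w g f)
    rw [mul_comm, weightedHomogeneousComponent_mul w (isWeightedHomogeneous_X k w v),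
      add_sub_cancel_right, mul_comm]
  idem g x := by
    classical
    obtain ⟨f, rfl⟩ := Ideal.Quotient.mk_surjective x
    refine congrArg (Ideal.Quotient.mk J) (?_ : weightedHomogeneousComponent w g
      (weightedHomogeneousComponent w g f) = weightedHomogeneousComponent w g f)
    ext a
    simp only [coeff_weightedHomogeneousComponent]
    split_ifs <;> rfl
  orth g h x hgh := by
    classical
    obtain ⟨f, rfl⟩ := Ideal.Quotient.mk_surjective x
    refine congrArg (Ideal.Quotient.mk J) (?_ : weightedHomogeneousComponent w g
      (weightedHomogeneousComponent w h f) = 0)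
    ext a
    simp only [coeff_weightedHomogeneousComponent]
    split_ifs with h1 h2
    · exact absurd (h1.symm.trans h2) hgh
    all_goals rfl
  exists_sum x := by
    obtain ⟨f, rfl⟩ := Ideal.Quotient.mk_surjective x
    refine ⟨(weightedHomogeneousComponent_finsupp (w := w) f).toFinset, ?_⟩
    have h := sum_weightedHomogeneousComponent w f
    rw [finsum_eq_sum _ (weightedHomogeneousComponent_finsupp f)] at h
    conv_rhs => rw [← h, map_sum]
    rfl

theorem quotient_mk (w : V → G) (J : Ideal (MvPolynomial V k)) (hJ) (g : G)
    (f : MvPolynomial V k) : (quotient w J hJ).p g (Ideal.Quotient.mk J f) =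
      Ideal.Quotient.mk J (weightedHomogeneousComponent w g f) := rfl

theorem mem_quotientDeg (J : Ideal (MvPolynomial V k)) (hJ) (n : ℤ) (x : MvPolynomial V k ⧸ J) :
    x ∈ quotientDeg J n ↔ (quotient (fun _ => (1 : ℤ)) J hJ).p n x = x := by
  have hw : ∀ (f : MvPolynomial V k) (m : ℕ),
      f.IsHomogeneous m ↔ IsWeightedHomogeneous (fun _ => (1 : ℤ)) f (m : ℤ) := by
    intro f m
    refine forall₂_congr fun a _ => ?_
    rw [weight_one_eq, Finsupp.degree_eq_weight_one, Nat.cast_inj]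
    rfl
  constructor
  · intro hx
    induction hx using Submodule.span_induction with
    | mem x hx =>
      obtain ⟨m, f, rfl, hf, rfl⟩ := hx
      rw [quotient_mk, ((hw f m).1 hf).weightedHomogeneousComponent_same]
    | zero => rw [map_zero]
    | add x y _ _ hx hy => rw [map_add, hx, hy]
    | smul c x _ hx => rw [map_smul, hx]
  · intro hx
    obtain ⟨f, rfl⟩ := Ideal.Quotient.mk_surjective x
    rw [← hx, quotient_mk]
    obtain hn | hn := lt_or_ge n 0
    · rw [weightedHomogeneousComponent_eq_zero', map_zero]
      · exact Submodule.zero_mem _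
      · intro a _
        rw [weight_one_eq]
        omega
    · obtain ⟨m, rfl⟩ := Int.eq_ofNat_of_zero_le hn
      exact Submodule.subset_span ⟨m, _, rfl,
        (hw _ m).2 (weightedHomogeneousComponent_isWeightedHomogeneous _ f), rfl⟩

end Quotient
end GradingProj

/-! ### Functoriality and the long exact sequence of local cohomology -/

section Functoriality

variable {k V : Type*} [Field k]
variable {M : Type*} [AddCommGroup M] [Module (MvPolynomial V k) M]
variable {N : Type*} [AddCommGroup N] [Module (MvPolynomial V k) N]

/-- The map `M_{x_S} → N_{x_S}` induced by a homomorphism of modules. -/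
def locMap (f : M →ₗ[MvPolynomial V k] N) (S : Finset V) :
    Loc k M S →ₗ[MvPolynomial V k] Loc k N S :=
  IsLocalizedModule.map (monomialsOn k S) (LocalizedModule.mkLinearMap (monomialsOn k S) M)
    (LocalizedModule.mkLinearMap (monomialsOn k S) N) f

theorem locMap_mk (f : M →ₗ[MvPolynomial V k] N) (S : Finset V) (m : M) (s : monomialsOn k S) :
    locMap f S (LocalizedModule.mk m s) = LocalizedModule.mk (f m) s := by
  rw [locMap, IsLocalizedModule.mk_eq_mk', IsLocalizedModule.map_mk',
    IsLocalizedModule.mk_eq_mk']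

theorem locMap_res (f : M →ₗ[MvPolynomial V k] N) {S T : Finset V} (h : S ⊆ T) (x : Loc k M S) :
    locMap f T (res h x) = res h (locMap f S x) := by
  induction x using LocalizedModule.induction_on with
  | _ m s => rw [res_mk, locMap_mk, locMap_mk, res_mk]

theorem res_res {S T U : Finset V} (h : S ⊆ T) (h' : T ⊆ U) (x : Loc k M S) :
    res h' (res h x) = res (h.trans h') x := by
  induction x using LocalizedModule.induction_on with
  | _ m s => rw [res_mk, res_mk, res_mk]

/-- The restriction to `M_{x_T}` of the entry of `c` at `S`, as a total function of `S` (zero unless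
`S ⊆ T`); this avoids transport along equalities of index sets. -/
def resTo (c : Cech (V := V) k M) (T S : Finset V) : Loc k M T :=
  haveI := Classical.dec (S ⊆ T)
  if h : S ⊆ T then res h (c S) else 0

theorem resTo_of_subset (c : Cech (V := V) k M) {T S : Finset V} (h : S ⊆ T) :
    resTo c T S = res h (c S) :=
  dif_pos h

theorem resTo_self (c : Cech (V := V) k M) (T : Finset V) : resTo c T T = c T := by
  rw [resTo_of_subset c (Finset.Subset.refl T)]
  induction c T using LocalizedModule.induction_on with
  | _ m s => rw [res_mk]

theorem res_resTo (c : Cech (V := V) k M) {S T U : Finset V} (h : S ⊆ T) (h' : T ⊆ U) :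
    res h' (resTo c T S) = resTo c U S := by
  rw [resTo_of_subset c h, res_res, resTo_of_subset c (h.trans h')]

theorem cechMap_apply (f : M →ₗ[MvPolynomial V k] N) (c : Cech (V := V) k M) (S : Finset V) :
    cechMap f c S = locMap f S (c S) := rfl

theorem cechMap_mem_cochains (f : M →ₗ[MvPolynomial V k] N) {p : ℕ} {c : Cech (V := V) k M}
    (hc : c ∈ cochains k M p) : cechMap f c ∈ cochains k N p := by
  rw [mem_cochains] at hc ⊢
  intro S hS
  rw [cechMap_apply, hc S hS, map_zero]

variable [LinearOrder V]

theorem cechD_eq_sum_resTo (c : Cech (V := V) k M) (T : Finset V) :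
    cechD k M c T = ∑ v ∈ T, (-1 : MvPolynomial V k) ^ (T.filter (· < v)).card •
      resTo c T (T.erase v) := by
  rw [cechD_apply]
  exact Finset.sum_congr rfl fun v _ => by rw [resTo_of_subset c (T.erase_subset v)]

theorem cechD_cechMap (f : M →ₗ[MvPolynomial V k] N) (c : Cech (V := V) k M) :
    cechD k N (cechMap f c) = cechMap f (cechD k M c) := by
  funext T
  rw [cechMap_apply, cechD_apply, cechD_apply, map_sum]
  refine Finset.sum_congr rfl fun v _ => ?_
  rw [map_smul, locMap_res, cechMap_apply]

theorem cechMap_mem_cocycles (f : M →ₗ[MvPolynomial V k] N) {p : ℕ} {c : Cech (V := V) k M}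
    (hc : c ∈ cocycles k M p) : cechMap f c ∈ cocycles k N p :=
  ⟨cechMap_mem_cochains f hc.1, LinearMap.mem_ker.2 (by
    rw [cechD_cechMap, LinearMap.mem_ker.1 hc.2, map_zero])⟩

theorem cechMap_mem_coboundaries (f : M →ₗ[MvPolynomial V k] N) {p : ℕ}
    {c : Cech (V := V) k M} (hc : c ∈ coboundaries k M p) :
    cechMap f c ∈ coboundaries k N p := by
  cases p with
  | zero =>
    rw [(Submodule.mem_bot _).1 hc, map_zero]
    exact Submodule.zero_mem _
  | succ p =>
    obtain ⟨b, hb, rfl⟩ := hc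
    exact ⟨_, cechMap_mem_cochains f hb, cechD_cechMap f b⟩

/-- The map on cocycles induced by a homomorphism of modules. -/
def cocycMap (f : M →ₗ[MvPolynomial V k] N) (p : ℕ) :
    cocycles (V := V) k M p →ₗ[MvPolynomial V k] cocycles (V := V) k N p :=
  (cechMap f).restrict fun _ hc => cechMap_mem_cocycles f hc

/-- The map on local cohomology induced by a homomorphism of modules. -/
def cohMap (f : M →ₗ[MvPolynomial V k] N) (p : ℕ) :
    LocalCoh (V := V) k M p →ₗ[MvPolynomial V k] LocalCoh (V := V) k N p :=
  Submodule.mapQ _ _ (cocycMap f p) fun _ hu => cechMap_mem_coboundaries f hu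

theorem cohMap_cls (f : M →ₗ[MvPolynomial V k] N) (p : ℕ) (u : cocycles (V := V) k M p) :
    cohMap f p (cls p u) = cls p (cocycMap f p u) := rfl

theorem cechD_mem_cochains {p : ℕ} {c : Cech (V := V) k M} (hc : c ∈ cochains k M p) :
    cechD k M c ∈ cochains k M (p + 1) := by
  rw [mem_cochains] at hc ⊢
  intro T hT
  rw [cechD_apply]
  refine Finset.sum_eq_zero fun v hv => ?_
  rw [hc, map_zero, smul_zero]
  rw [Finset.card_erase_of_mem hv]
  have := Finset.card_pos.2 ⟨v, hv⟩
  omega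

/-- The exponents of the signs in the Čech differential: deleting `u` changes the number of elements
below `v` by one exactly if `u < v`. -/
theorem card_filter_lt_erase {T : Finset V} {u : V} (hu : u ∈ T) (v : V) :
    (T.filter (· < v)).card = ((T.erase u).filter (· < v)).card + if u < v then 1 else 0 := by
  rw [Finset.filter_erase]
  split_ifs with h
  · rw [Finset.card_erase_add_one (Finset.mem_filter.2 ⟨hu, h⟩)]
  · rw [Finset.erase_eq_of_notMem (a := u) (fun h' => h (Finset.mem_filter.1 h').2), add_zero]

theorem sign_swap {T : Finset V} {u v : V} (hu : u ∈ T) (hv : v ∈ T) (huv : u ≠ v) :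
    (-1 : MvPolynomial V k) ^ (T.filter (· < v)).card *
        (-1) ^ ((T.erase v).filter (· < u)).card =
      -((-1) ^ (T.filter (· < u)).card * (-1) ^ ((T.erase u).filter (· < v)).card) := by
  rw [card_filter_lt_erase hu v, card_filter_lt_erase hv u]
  rcases lt_or_gt_of_ne huv with h | h
  · rw [if_pos h, if_neg h.not_gt]
    ring
  · rw [if_pos h, if_neg h.not_gt]
    ring

theorem cechD_cechD (c : Cech (V := V) k M) : cechD k M (cechD k M c) = 0 := by
  funext T
  have h1 : cechD k M (cechD k M c) T = ∑ q ∈ T.offDiag,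
      ((-1 : MvPolynomial V k) ^ (T.filter (· < q.1)).card *
        (-1) ^ ((T.erase q.1).filter (· < q.2)).card) • resTo c T ((T.erase q.1).erase q.2) := by
    have h2 : T.offDiag = T.biUnion fun v => (T.erase v).image fun u => (v, u) := by
      ext ⟨v, u⟩
      simp only [Finset.mem_offDiag, Finset.mem_biUnion, Finset.mem_image, Finset.mem_erase,
        Prod.mk.injEq]
      constructor
      · rintro ⟨hv, hu, h⟩
        exact ⟨v, hv, u, ⟨h.symm, hu⟩, rfl, rfl⟩
      · rintro ⟨v, hv, u, ⟨h, hu⟩, rfl, rfl⟩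
        exact ⟨hv, hu, h.symm⟩
    rw [h2, Finset.sum_biUnion, cechD_eq_sum_resTo]
    · refine Finset.sum_congr rfl fun v _ => ?_
      rw [Finset.sum_image (by intro a _ b _ h; exact (Prod.mk.inj h).2),
        resTo_of_subset _ (T.erase_subset v), cechD_eq_sum_resTo, map_sum, Finset.smul_sum]
      refine Finset.sum_congr rfl fun u _ => ?_
      rw [map_smul, res_resTo c ((T.erase v).erase_subset u), smul_smul]
    · intro v _ v' _ hvv'
      rw [Function.onFun, Finset.disjoint_left]
      intro q hq hq'
      obtain ⟨_, _, rfl⟩ := Finset.mem_image.1 hq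
      obtain ⟨_, _, h⟩ := Finset.mem_image.1 hq'
      exact hvv' (Prod.mk.inj h).1.symm
  rw [h1, Pi.zero_apply]
  refine Finset.sum_involution (fun q _ => q.swap) ?_ ?_ ?_ ?_
  · rintro ⟨v, u⟩ hq
    obtain ⟨hv, hu, h⟩ := Finset.mem_offDiag.1 hq
    dsimp only [Prod.swap, Prod.fst, Prod.snd] at hv hu h ⊢
    rw [sign_swap hu hv h.symm, Finset.erase_right_comm, neg_smul, neg_add_cancel]
  · rintro ⟨v, u⟩ hq _ h
    exact (Finset.mem_offDiag.1 hq).2.2 (Prod.mk.inj h).2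
  · rintro ⟨v, u⟩ hq
    obtain ⟨hv, hu, h⟩ := Finset.mem_offDiag.1 hq
    exact Finset.mem_offDiag.2 ⟨hu, hv, h.symm⟩
  · rintro ⟨v, u⟩ _
    rfl

end Functoriality

namespace GradingProj

variable {k V G : Type*} [Field k] [AddCommGroup G] {w : V → G}
variable {M : Type*} [AddCommGroup M] [Module k M] [Module (MvPolynomial V k) M]
variable [IsScalarTower k (MvPolynomial V k) M]
variable {N : Type*} [AddCommGroup N] [Module k N] [Module (MvPolynomial V k) N]
variable [IsScalarTower k (MvPolynomial V k) N]
variable {D : GradingProj (k := k) w M} {E : GradingProj (k := k) w N}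

theorem locMap_loc {f : M →ₗ[MvPolynomial V k] N} (hf : ∀ g m, f (D.p g m) = E.p g (f m))
    (S : Finset V) (g : G) (x : Loc k M S) :
    locMap f S (D.loc S g x) = E.loc S g (locMap f S x) := by
  induction x using LocalizedModule.induction_on with
  | _ m s => rw [loc_mk, locMap_mk, locMap_mk, loc_mk, hf]

theorem cechMap_cech {f : M →ₗ[MvPolynomial V k] N} (hf : ∀ g m, f (D.p g m) = E.p g (f m))
    (g : G) (c : Cech (V := V) k M) : cechMap f (D.cech g c) = E.cech g (cechMap f c) := by
  funext S
  rw [cechMap_apply, cech_apply, cech_apply, cechMap_apply, locMap_loc hf]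

theorem cohMap_coh [LinearOrder V] [Fintype V] {f : M →ₗ[MvPolynomial V k] N}
    (hf : ∀ g m, f (D.p g m) = E.p g (f m)) (p : ℕ) (g : G) (x : LocalCoh (V := V) k M p) :
    cohMap f p ((D.coh p).p g x) = (E.coh p).p g (cohMap f p x) := by
  obtain ⟨u, rfl⟩ := cls_surjective p x
  exact congrArg (cls p) (Subtype.ext (cechMap_cech hf g u))

end GradingProj

section LongExact

variable {k V : Type*} [Field k]
variable {M : Type*} [AddCommGroup M] [Module (MvPolynomial V k) M]
variable {N : Type*} [AddCommGroup N] [Module (MvPolynomial V k) N]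

/-- The hypotheses for the long exact sequence: `π` is the projection `M → M/θM`, and `θ` is a
nonzerodivisor on all nontrivial localizations `M_{x_S}` (but not necessarily on `M`). -/
structure FilterRegular (π : M →ₗ[MvPolynomial V k] N) (θ : MvPolynomial V k) : Prop where
  surjective : Function.Surjective π
  exact : ∀ m, π m = 0 → ∃ m', m = θ • m'
  map_smul_eq_zero : ∀ m, π (θ • m) = 0
  injective : ∀ S : Finset V, S.Nonempty → ∀ x : Loc k M S, θ • x = 0 → x = 0

namespace FilterRegular

variable {π : M →ₗ[MvPolynomial V k] N} {θ : MvPolynomial V k} (h : FilterRegular π θ)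
include h

theorem exists_lift {p : ℕ} {c : Cech (V := V) k N} (hc : c ∈ cochains k N p) :
    ∃ z ∈ cochains (V := V) k M p, cechMap π z = c := by
  have hS : ∀ S : Finset V, ∃ x : Loc k M S, locMap π S x = c S ∧ (S.card ≠ p → x = 0) := by
    intro S
    by_cases hSp : S.card = p
    · induction hx : c S using LocalizedModule.induction_on with
      | _ m s =>
        obtain ⟨m', rfl⟩ := h.surjective m
        exact ⟨LocalizedModule.mk m' s, locMap_mk π S m' s, fun hn => absurd hSp hn⟩
    · exact ⟨0, by rw [map_zero, mem_cochains.1 hc S hSp], fun _ => rfl⟩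
  choose z hz hz0 using hS
  exact ⟨z, mem_cochains.2 hz0, funext hz⟩

theorem exists_smul_eq {p : ℕ} {z : Cech (V := V) k M} (hz : z ∈ cochains k M p)
    (hπz : cechMap π z = 0) : ∃ w ∈ cochains (V := V) k M p, z = θ • w := by
  have hS : ∀ S : Finset V, ∃ x : Loc k M S, z S = θ • x ∧ (S.card ≠ p → x = 0) := by
    intro S
    by_cases hSp : S.card = p
    · have hπS : locMap π S (z S) = 0 := congrFun hπz S
      induction hx : z S using LocalizedModule.induction_on with
      | _ m s =>
        rw [hx, locMap_mk, ← LocalizedModule.zero_mk (1 : monomialsOn k S),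
          LocalizedModule.mk_eq] at hπS
        obtain ⟨u, hu⟩ := hπS
        rw [one_smul, smul_zero, smul_zero, Submonoid.smul_def, ← map_smul] at hu
        obtain ⟨m', hm'⟩ := h.exact _ hu
        refine ⟨LocalizedModule.mk m' (u * s), ?_, fun hn => absurd hSp hn⟩
        rw [LocalizedModule.smul'_mk, ← hm', ← Submonoid.smul_def,
          LocalizedModule.mk_cancel_common_left]
    · exact ⟨0, by rw [smul_zero, mem_cochains.1 hz S hSp], fun _ => rfl⟩
  choose w hw hw0 using hS
  exact ⟨w, mem_cochains.2 hw0, funext hw⟩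

theorem eq_zero_of_smul {p : ℕ} {w : Cech (V := V) k M} (hw : w ∈ cochains k M (p + 1))
    (hθ : θ • w = 0) : w = 0 := by
  funext S
  by_cases hS : S.card = p + 1
  · exact h.injective S (Finset.card_pos.1 (by omega)) _ (congrFun hθ S)
  · exact mem_cochains.1 hw S hS

theorem cechMap_smul (c : Cech (V := V) k M) : cechMap π (θ • c) = 0 := by
  funext S
  rw [cechMap_apply, Pi.smul_apply, Pi.zero_apply]
  induction c S using LocalizedModule.induction_on with
  | _ m s => rw [LocalizedModule.smul'_mk, locMap_mk, h.map_smul_eq_zero, LocalizedModule.zero_mk]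

variable [LinearOrder V]

theorem mem_cocycles_of_smul {p : ℕ} {w z : Cech (V := V) k M} (hw : w ∈ cochains k M p)
    (hz : cechD k M z = θ • w) : w ∈ cocycles k M p := by
  refine ⟨hw, LinearMap.mem_ker.2 (h.eq_zero_of_smul (cechD_mem_cochains hw) ?_)⟩
  rw [← map_smul, ← hz, cechD_cechD]

theorem exists_connecting (i : ℕ) (x : LocalCoh (V := V) k N i) :
    ∃ y, Connecting π θ i x y := by
  obtain ⟨u, rfl⟩ := cls_surjective i x
  obtain ⟨z, hz, hzu⟩ := h.exists_lift u.2.1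
  obtain ⟨w, hw, hzw⟩ := h.exists_smul_eq (cechD_mem_cochains hz) (by
    rw [← cechD_cechMap, hzu, LinearMap.mem_ker.1 u.2.2])
  exact ⟨_, z, hz, u, ⟨w, h.mem_cocycles_of_smul hw hzw⟩, hzu, hzw, rfl, rfl⟩

/-- The key diagram chase: if the class of `π z` vanishes and `d z = θ w`, then `w` bounds. -/
theorem mem_coboundaries {i : ℕ} {z w : Cech (V := V) k M} (hz : z ∈ cochains k M i)
    (hw : w ∈ cochains k M (i + 1)) (hzw : cechD k M z = θ • w)
    (hπz : cechMap π z ∈ coboundaries k N i) : w ∈ coboundaries k M (i + 1) := by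
  obtain ⟨y, hy, hyz, hdy⟩ : ∃ y ∈ cochains (V := V) k M i, cechMap π (z - y) = 0 ∧
      cechD k M y = 0 := by
    cases i with
    | zero => exact ⟨0, Submodule.zero_mem _, by rw [sub_zero]; exact hπz, map_zero _⟩
    | succ i =>
      obtain ⟨b, hb, hbz⟩ := hπz
      obtain ⟨b', hb', rfl⟩ := h.exists_lift hb
      refine ⟨_, cechD_mem_cochains hb', ?_, cechD_cechD b'⟩
      rw [map_sub, ← hbz, cechD_cechMap, sub_self]
  obtain ⟨t, ht, hzt⟩ := h.exists_smul_eq (Submodule.sub_mem _ hz hy) hyz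
  refine ⟨t, ht, ?_⟩
  refine (sub_eq_zero.1 (h.eq_zero_of_smul (Submodule.sub_mem _ hw (cechD_mem_cochains ht)) ?_)).symm
  rw [smul_sub, ← hzw, ← map_smul, ← hzt, map_sub, hdy, sub_zero, sub_self]

theorem connecting_unique {i : ℕ} {x : LocalCoh (V := V) k N i}
    {y y' : LocalCoh (V := V) k M (i + 1)} (hy : Connecting π θ i x y)
    (hy' : Connecting π θ i x y') : y = y' := by
  obtain ⟨z, hz, u, w, hzu, hzw, rfl, rfl⟩ := hy
  obtain ⟨z', hz', u', w', hzu', hzw', huu', rfl⟩ := hy'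
  rw [← sub_eq_zero, ← map_sub, cls_eq_zero]
  refine h.mem_coboundaries (Submodule.sub_mem _ hz hz')
    (Submodule.sub_mem _ w.2.1 w'.2.1) ?_ ?_
  · rw [map_sub, hzw, hzw', ← smul_sub]
    rfl
  · rw [map_sub, hzu, hzu']
    exact (cls_eq_zero (u := u - u')).1 (by rw [map_sub, huu', sub_self])

end FilterRegular

variable [LinearOrder V]

theorem Connecting.add {π : M →ₗ[MvPolynomial V k] N} {θ : MvPolynomial V k} {i : ℕ}
    {x x' : LocalCoh (V := V) k N i} {y y' : LocalCoh (V := V) k M (i + 1)}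
    (hy : Connecting π θ i x y) (hy' : Connecting π θ i x' y') :
    Connecting π θ i (x + x') (y + y') := by
  obtain ⟨z, hz, u, w, hzu, hzw, rfl, rfl⟩ := hy
  obtain ⟨z', hz', u', w', hzu', hzw', rfl, rfl⟩ := hy'
  refine ⟨z + z', Submodule.add_mem _ hz hz', u + u', w + w', ?_, ?_, map_add _ _ _, map_add _ _ _⟩
  · rw [map_add, hzu, hzu']; rfl
  · rw [map_add, hzw, hzw', ← smul_add]; rfl

theorem Connecting.smul {π : M →ₗ[MvPolynomial V k] N} {θ : MvPolynomial V k} {i : ℕ}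
    {x : LocalCoh (V := V) k N i} {y : LocalCoh (V := V) k M (i + 1)}
    (a : MvPolynomial V k) (hy : Connecting π θ i x y) : Connecting π θ i (a • x) (a • y) := by
  obtain ⟨z, hz, u, w, hzu, hzw, rfl, rfl⟩ := hy
  refine ⟨a • z, Submodule.smul_mem _ a hz, a • u, a • w, ?_, ?_, map_smul _ _ _, map_smul _ _ _⟩
  · rw [map_smul, hzu]; rfl
  · rw [map_smul, hzw, smul_comm]; rfl

namespace FilterRegular

variable {π : M →ₗ[MvPolynomial V k] N} {θ : MvPolynomial V k} (h : FilterRegular π θ)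

/-- The connecting homomorphism as a linear map. -/
def delta (i : ℕ) : LocalCoh (V := V) k N i →ₗ[MvPolynomial V k] LocalCoh (V := V) k M (i + 1) where
  toFun x := (h.exists_connecting i x).choose
  map_add' x x' := h.connecting_unique (h.exists_connecting i (x + x')).choose_spec
    ((h.exists_connecting i x).choose_spec.add (h.exists_connecting i x').choose_spec)
  map_smul' a x := h.connecting_unique (h.exists_connecting i (a • x)).choose_spec
    ((h.exists_connecting i x).choose_spec.smul a)

theorem connecting_delta (i : ℕ) (x : LocalCoh (V := V) k N i) :
    Connecting π θ i x (h.delta i x) :=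
  (h.exists_connecting i x).choose_spec

theorem delta_eq {i : ℕ} {x : LocalCoh (V := V) k N i} {y : LocalCoh (V := V) k M (i + 1)}
    (hxy : Connecting π θ i x y) : h.delta i x = y :=
  h.connecting_unique (h.connecting_delta i x) hxy

theorem delta_cohMap (i : ℕ) (x : LocalCoh (V := V) k M i) : h.delta i (cohMap π i x) = 0 := by
  obtain ⟨z, rfl⟩ := cls_surjective i x
  refine h.delta_eq ⟨z, z.2.1, cocycMap π i z, 0, rfl, ?_, rfl, map_zero _⟩
  rw [LinearMap.mem_ker.1 z.2.2, Submodule.coe_zero, smul_zero]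

theorem exists_cohMap_eq {i : ℕ} {x : LocalCoh (V := V) k N i} (hx : h.delta i x = 0) :
    ∃ y, cohMap π i y = x := by
  obtain ⟨z, hz, u, w, hzu, hzw, rfl, hw⟩ := h.connecting_delta i x
  rw [hx, cls_eq_zero] at hw
  obtain ⟨t, ht, htw⟩ := hw
  refine ⟨cls i ⟨z - θ • t, Submodule.sub_mem _ hz (Submodule.smul_mem _ _ ht),
    LinearMap.mem_ker.2 ?_⟩, ?_⟩
  · rw [map_sub, map_smul, htw, hzw, sub_self]
  · rw [cohMap_cls]
    refine congrArg (cls i) (Subtype.ext ?_)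
    change cechMap π (z - θ • t) = u
    rw [map_sub, h.cechMap_smul, sub_zero, hzu]

theorem smul_delta (i : ℕ) (x : LocalCoh (V := V) k N i) : θ • h.delta i x = 0 := by
  obtain ⟨z, hz, u, w, hzu, hzw, rfl, hw⟩ := h.connecting_delta i x
  rw [← hw, ← map_smul, cls_eq_zero]
  exact ⟨z, hz, hzw⟩

theorem exists_delta_eq {i : ℕ} {y : LocalCoh (V := V) k M (i + 1)} (hy : θ • y = 0) :
    ∃ x, h.delta i x = y := by
  obtain ⟨w, rfl⟩ := cls_surjective _ y
  rw [← map_smul, cls_eq_zero] at hy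
  obtain ⟨z, hz, hzw⟩ := hy
  refine ⟨cls i ⟨cechMap π z, cechMap_mem_cochains π hz, LinearMap.mem_ker.2 ?_⟩,
    h.delta_eq ⟨z, hz, _, w, rfl, hzw, rfl, rfl⟩⟩
  rw [cechD_cechMap, hzw]
  exact h.cechMap_smul _

theorem cohMap_smul (h : FilterRegular π θ) (i : ℕ) (y : LocalCoh (V := V) k M i) :
    cohMap π i (θ • y) = 0 := by
  obtain ⟨u, rfl⟩ := cls_surjective _ y
  rw [← map_smul, cohMap_cls, cls_eq_zero]
  change cechMap π (θ • (u : Cech (V := V) k M)) ∈ _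
  rw [h.cechMap_smul]
  exact Submodule.zero_mem _

theorem exists_smul_eq_of_cohMap (h : FilterRegular π θ) {i : ℕ}
    {y : LocalCoh (V := V) k M i} (hy : cohMap π i y = 0) :
    ∃ y', θ • y' = y := by
  obtain ⟨u, rfl⟩ := cls_surjective _ y
  rw [cohMap_cls, cls_eq_zero] at hy
  obtain ⟨b, hb, hbd, hbu⟩ : ∃ b ∈ coboundaries (V := V) k M i,
      b ∈ cocycles (V := V) k M i ∧ cechMap π (u - b) = 0 := by
    cases i with
    | zero => exact ⟨0, Submodule.zero_mem _, Submodule.zero_mem _, by rw [sub_zero]; exact hy⟩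
    | succ i =>
      obtain ⟨b, hb, hbu⟩ := hy
      obtain ⟨b', hb', rfl⟩ := h.exists_lift hb
      refine ⟨_, ⟨b', hb', rfl⟩, ⟨cechD_mem_cochains hb', LinearMap.mem_ker.2 (cechD_cechD b')⟩, ?_⟩
      rw [map_sub, ← cechD_cechMap, hbu]
      exact sub_self _
  obtain ⟨w, hw, huw⟩ := h.exists_smul_eq (Submodule.sub_mem _ u.2.1 hbd.1) hbu
  have hwc : w ∈ cocycles k M i := by
    refine ⟨hw, LinearMap.mem_ker.2 (h.eq_zero_of_smul (cechD_mem_cochains hw) ?_)⟩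
    rw [← map_smul, ← huw, map_sub, LinearMap.mem_ker.1 u.2.2, LinearMap.mem_ker.1 hbd.2, sub_self]
  refine ⟨cls i ⟨w, hwc⟩, ?_⟩
  rw [← map_smul, ← sub_eq_zero, ← map_sub, cls_eq_zero]
  change θ • w - (u : Cech (V := V) k M) ∈ _
  rw [← huw, sub_sub_cancel_left]
  exact Submodule.neg_mem _ hb

/-- The connecting homomorphism lowers degrees by one. -/
theorem delta_coh [Fintype V] [Module k M] [IsScalarTower k (MvPolynomial V k) M] [Module k N]
    [IsScalarTower k (MvPolynomial V k) N]
    (D : GradingProj (k := k) (V := V) (fun _ => (1 : ℤ)) M)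
    (E : GradingProj (k := k) (V := V) (fun _ => (1 : ℤ)) N)
    (hπ : ∀ g m, π (D.p g m) = E.p g (π m))
    (hθ : ∀ (n : ℤ) (c : Cech (V := V) k M), D.cech (n + 1) (θ • c) = θ • D.cech n c)
    (i : ℕ) (n : ℤ) (x : LocalCoh (V := V) k N i) :
    h.delta i ((E.coh i).p (n + 1) x) = (D.coh (i + 1)).p n (h.delta i x) := by
  obtain ⟨z, hz, u, w, hzu, hzw, hx, hw⟩ := h.connecting_delta i x
  rw [← hw, ← hx]
  refine h.delta_eq ⟨D.cech (n + 1) z, D.cech_mem_cochains _ hz, E.cocyc i (n + 1) u,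
    D.cocyc (i + 1) n w, ?_, ?_, rfl, rfl⟩
  · rw [GradingProj.cechMap_cech hπ, hzu]
    rfl
  · rw [D.cechD_cech, hzw, hθ]
    rfl

end FilterRegular

end LongExact

/-! ### Local cohomology of squarefree monomial quotients in nonnegative degrees -/

/-- An ideal spanned by monomials that contains with a monomial all monomials of larger support:
a squarefree monomial ideal. -/
structure IsSquarefreeMonomial {k V : Type*} [Field k] [DecidableEq V]
    (J : Ideal (MvPolynomial V k)) : Prop where
  component_mem : ∀ g, ∀ f ∈ J,
    weightedHomogeneousComponent (fun v => (Pi.single v 1 : V → ℤ)) g f ∈ J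
  mem_of_support_subset : ∀ a b : V →₀ ℕ, a.support ⊆ b.support →
    monomial a (1 : k) ∈ J → monomial b (1 : k) ∈ J

section Fine

variable {k V : Type*} [Field k] [DecidableEq V]

theorem weight_single_eq (a : V →₀ ℕ) (v : V) :
    Finsupp.weight (fun v => (Pi.single v 1 : V → ℤ)) a v = a v := by
  rw [Finsupp.weight_apply, Finsupp.sum, Finset.sum_apply]
  rw [Finset.sum_eq_single v]
  · simp
  · intro u _ huv
    simp [huv.symm]
  · intro hv
    rw [Finsupp.notMem_support_iff.1 hv, zero_smul, Pi.zero_apply]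

namespace IsSquarefreeMonomial

variable {J : Ideal (MvPolynomial V k)} (hJ : IsSquarefreeMonomial J)

/-- The fine grading of `A ⧸ J`. -/
def fine : GradingProj (k := k) (fun v => (Pi.single v 1 : V → ℤ)) (MvPolynomial V k ⧸ J) :=
  GradingProj.quotient _ J hJ.component_mem

/-- A homogeneous element of a localization, for the fine grading, is a scalar multiple of a
fraction of monomials. -/
theorem exists_eq_mk {S : Finset V} {g : V → ℤ} {y : Loc k (MvPolynomial V k ⧸ J) S}
    (hy : hJ.fine.loc S g y = y) :
    ∃ (b : V →₀ ℕ) (hb : ∀ v ∉ S, b v = 0) (x : MvPolynomial V k ⧸ J),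
      y = LocalizedModule.mk x (⟨monomial b 1, monomial_mem_monomialsOn hb⟩ : monomialsOn k S) ∧
      (x = 0 ∨ ∃ (a : V →₀ ℕ) (c : k), (∀ v, (a v : ℤ) = g v + b v) ∧
        x = Ideal.Quotient.mk J (monomial a c)) := by
  induction y using LocalizedModule.induction_on with
  | _ m s =>
    obtain ⟨s, hs⟩ := s
    obtain ⟨b, hb, rfl⟩ := exists_eq_monomial hs
    obtain ⟨f, rfl⟩ := Ideal.Quotient.mk_surjective m
    refine ⟨b, hb, _, hy.symm, ?_⟩
    rw [monWeight_monomial]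
    change Ideal.Quotient.mk J _ = 0 ∨ ∃ (a : V →₀ ℕ) (c : k), _ ∧ Ideal.Quotient.mk J _ = _
    set w : V → V → ℤ := fun v => Pi.single v 1
    by_cases ha : ∃ a : V →₀ ℕ, Finsupp.weight w a = g + Finsupp.weight w b
    · obtain ⟨a, ha⟩ := ha
      refine Or.inr ⟨a, coeff a f, fun v => ?_, congrArg (Ideal.Quotient.mk J) ?_⟩
      · have := congrFun ha v
        rwa [Pi.add_apply, weight_single_eq, weight_single_eq] at this
      · classical
        change weightedHomogeneousComponent w _ f = _
        ext a'
        rw [coeff_weightedHomogeneousComponent, coeff_monomial, ← ha]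
        have hiff : Finsupp.weight w a' = Finsupp.weight w a ↔ a = a' := by
          constructor
          · intro h
            ext v
            have := congrFun h v
            rw [weight_single_eq, weight_single_eq] at this
            exact_mod_cast this.symm
          · rintro rfl
            rfl
        by_cases h : a = a'
        · rw [if_pos h, if_pos (hiff.2 h), h]
        · rw [if_neg h, if_neg (fun e => h (hiff.1 e))]
    · refine Or.inl ?_
      change Ideal.Quotient.mk J (weightedHomogeneousComponent w _ f) = 0
      rw [weightedHomogeneousComponent_eq_zero' _ _ fun a _ h => ha ⟨a, h⟩, map_zero]

theorem mk_C_monomial_eq_zero {a b : V →₀ ℕ} (hab : a.support ⊆ b.support) {c : k}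
    (hJ : IsSquarefreeMonomial J)
    (h : Ideal.Quotient.mk J (monomial a c) = 0) : Ideal.Quotient.mk J (monomial b c) = 0 := by
  by_cases hc : c = 0
  · rw [hc, monomial_zero, map_zero]
  rw [Ideal.Quotient.eq_zero_iff_mem] at h ⊢
  have h1 : monomial a (1 : k) ∈ J := by
    have := Ideal.mul_mem_left J (C c⁻¹) h
    rwa [C_mul_monomial, inv_mul_cancel₀ hc] at this
  have := Ideal.mul_mem_left J (C c) (hJ.mem_of_support_subset a b hab h1)
  rwa [C_mul_monomial, mul_one] at this

theorem eq_zero_of_res_eq_zero {S : Finset V} {v : V} (hv : v ∉ S) {g : V → ℤ} (hg : 0 < g v)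
    {y : Loc k (MvPolynomial V k ⧸ J) S} (hy : hJ.fine.loc S g y = y)
    (h0 : res (Finset.subset_insert v S) y = 0) : y = 0 := by
  obtain ⟨b, hb, x, rfl, rfl | ⟨a, c, ha, rfl⟩⟩ := hJ.exists_eq_mk hy
  · exact LocalizedModule.zero_mk _
  rw [res_mk, ← LocalizedModule.zero_mk (1 : monomialsOn k (insert v S)),
    LocalizedModule.mk_eq] at h0
  obtain ⟨⟨u, hu⟩, h0⟩ := h0
  obtain ⟨e, he, rfl⟩ := exists_eq_monomial hu
  rw [one_smul, smul_zero, smul_zero, Submonoid.smul_def] at h0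
  have h1 : Ideal.Quotient.mk J (monomial (e + a) c) = 0 := by
    rw [← one_mul c, ← monomial_mul]
    exact h0
  have he' : ∀ u ∉ S, e.erase v u = 0 := by
    intro u hu
    by_cases huv : u = v
    · rw [huv, Finsupp.erase_same]
    · rw [Finsupp.erase_ne huv, he u (by simp [hu, huv])]
  have h2 : Ideal.Quotient.mk J (monomial (e.erase v + a) c) = 0 := by
    refine mk_C_monomial_eq_zero ?_ hJ h1
    intro u hu
    rw [Finsupp.mem_support_iff, Finsupp.add_apply] at hu ⊢
    by_cases huv : u = v
    · have := ha v
      rw [hb v hv] at this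
      subst huv
      omega
    · rwa [Finsupp.erase_ne huv]
  rw [← LocalizedModule.zero_mk (1 : monomialsOn k S), LocalizedModule.mk_eq]
  refine ⟨⟨monomial (e.erase v) 1, monomial_mem_monomialsOn he'⟩, ?_⟩
  rw [one_smul, smul_zero, smul_zero, Submonoid.smul_def]
  rw [← one_mul c, ← monomial_mul] at h2
  exact h2

theorem exists_res_eq {S : Finset V} {v : V} (hv : v ∉ S) {g : V → ℤ} (hg : 0 < g v)
    {y : Loc k (MvPolynomial V k ⧸ J) (insert v S)} (hy : hJ.fine.loc (insert v S) g y = y) :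
    ∃ x : Loc k (MvPolynomial V k ⧸ J) S, hJ.fine.loc S g x = x ∧
      res (Finset.subset_insert v S) x = y := by
  obtain ⟨b, hb, x, rfl, rfl | ⟨a, c, ha, rfl⟩⟩ := hJ.exists_eq_mk hy
  · exact ⟨0, map_zero _, by rw [map_zero, LocalizedModule.zero_mk]⟩
  have hbv : Finsupp.single v (b v) ≤ a := by
    rw [Finsupp.single_le_iff]
    have := ha v
    omega
  have hb' : ∀ u ∉ S, b.erase v u = 0 := by
    intro u hu
    by_cases huv : u = v
    · rw [huv, Finsupp.erase_same]
    · rw [Finsupp.erase_ne huv, hb u (by simp [hu, huv])]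
  refine ⟨LocalizedModule.mk (Ideal.Quotient.mk J (monomial (a - Finsupp.single v (b v)) c))
    (⟨monomial (b.erase v) 1, monomial_mem_monomialsOn hb'⟩ : monomialsOn k S), ?_, ?_⟩
  · rw [GradingProj.loc_mk, monWeight_monomial]
    refine congrArg (LocalizedModule.mk · _) (congrArg (Ideal.Quotient.mk J) ?_)
    refine (isWeightedHomogeneous_monomial _ _ _ ?_).weightedHomogeneousComponent_same
    ext u
    rw [Pi.add_apply, weight_single_eq, weight_single_eq, Finsupp.tsub_apply]
    have := ha u
    by_cases huv : u = v
    · subst huv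
      rw [Finsupp.single_eq_same, Finsupp.erase_same]
      omega
    · rw [Finsupp.single_eq_of_ne huv, Finsupp.erase_ne huv]
      omega
  · rw [res_mk, LocalizedModule.mk_eq]
    refine ⟨1, ?_⟩
    rw [one_smul, one_smul, Submonoid.smul_def, Submonoid.smul_def]
    change Ideal.Quotient.mk J (monomial b 1 * monomial (a - Finsupp.single v (b v)) c) =
      Ideal.Quotient.mk J (monomial (b.erase v) 1 * monomial a c)
    rw [monomial_mul, monomial_mul, one_mul]
    refine congrArg (fun e => Ideal.Quotient.mk J (monomial e c)) ?_
    ext u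
    have := ha u
    simp only [Finsupp.add_apply, Finsupp.tsub_apply]
    by_cases huv : u = v
    · subst huv
      rw [Finsupp.single_eq_same, Finsupp.erase_same]
      omega
    · rw [Finsupp.single_eq_of_ne huv, Finsupp.erase_ne huv]
      omega

end IsSquarefreeMonomial
end Fine

namespace IsSquarefreeMonomial

variable {k V : Type*} [Field k] [LinearOrder V]
variable {J : Ideal (MvPolynomial V k)} (hJ : IsSquarefreeMonomial J)

/-- In a fine degree `g` with `g v > 0`, the Čech complex has a contracting homotopy: the inverses
of the restrictions from `M_{x_S}` to `M_{x_{S ∪ v}}`. -/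
theorem mem_coboundaries_of_pos {v : V} {g : V → ℤ} (hg : 0 < g v) {p : ℕ}
    {c : Cech (V := V) k (MvPolynomial V k ⧸ J)} (hc : c ∈ cocycles k _ p)
    (hgc : hJ.fine.cech g c = c) : c ∈ coboundaries k _ p := by
  have hloc : ∀ S, hJ.fine.loc S g (c S) = c S := fun S => congrFun hgc S
  have hb : ∀ S : Finset V, ∃ x : Loc k (MvPolynomial V k ⧸ J) S, hJ.fine.loc S g x = x ∧
      (v ∈ S → x = 0) ∧ (v ∉ S → res (Finset.subset_insert v S) x =
        (-1 : MvPolynomial V k) ^ (S.filter (· < v)).card • c (insert v S)) := by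
    intro S
    by_cases hv : v ∈ S
    · exact ⟨0, map_zero _, fun _ => rfl, fun h => absurd hv h⟩
    · obtain ⟨x, hx, hx'⟩ := hJ.exists_res_eq hv hg
        (y := (-1 : MvPolynomial V k) ^ (S.filter (· < v)).card • c (insert v S))
        (by rw [GradingProj.loc_neg_one_pow_smul, hloc])
      exact ⟨x, hx, fun h => absurd h hv, fun _ => hx'⟩
  choose b hbg hb0 hbres using hb
  have hresb : ∀ S T : Finset V, v ∉ S → insert v S ⊆ T → resTo b T S =
      (-1 : MvPolynomial V k) ^ (S.filter (· < v)).card • resTo c T (insert v S) := by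
    intro S T hv hST
    rw [resTo_of_subset c hST, ← map_smul, ← hbres S hv, res_res, resTo_of_subset]
  have hfilter : ∀ S : Finset V, (insert v S).filter (· < v) = S.filter (· < v) := by
    intro S
    rw [Finset.filter_insert, if_neg (lt_irrefl v)]
  have hsq : ∀ n : ℕ, (-1 : MvPolynomial V k) ^ n * (-1) ^ n = 1 := by
    intro n
    rw [← mul_pow, neg_one_mul, neg_neg, one_pow]
  have hdb : cechD k _ b = c := by
    funext T
    by_cases hvT : v ∈ T
    · rw [cechD_eq_sum_resTo, Finset.sum_eq_single v]
      · have h1 := Finset.insert_erase hvT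
        rw [hresb _ _ (Finset.notMem_erase v T) h1.subset, h1, resTo_self, smul_smul]
        rw [show (T.erase v).filter (· < v) = T.filter (· < v) by
          rw [← hfilter, h1], hsq, one_smul]
      · intro u hu huv
        rw [resTo_of_subset _ (T.erase_subset u), hb0 _ (Finset.mem_erase.2 ⟨huv.symm, hvT⟩),
          map_zero, smul_zero]
      · exact fun h => absurd hvT h
    · -- both sides have degree `g`, so it suffices to compare them after restriction to `T ∪ v`
      rw [← sub_eq_zero]
      refine hJ.eq_zero_of_res_eq_zero hvT hg (g := g) ?_ ?_
      · rw [map_sub, hloc]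
        congr 1
        have := congrFun (hJ.fine.cechD_cech g b) T
        rw [GradingProj.cech_apply] at this
        rw [← this, show hJ.fine.cech g b = b from _root_.funext hbg]
      have hdc : cechD k _ c (insert v T) = 0 := congrFun (LinearMap.mem_ker.1 hc.2) (insert v T)
      rw [cechD_eq_sum_resTo, Finset.sum_insert hvT, Finset.erase_insert hvT] at hdc
      rw [map_sub, cechD_eq_sum_resTo, map_sum, sub_eq_zero, ← resTo_of_subset]
      have h2 : ∀ u ∈ T, res (Finset.subset_insert v T)
          ((-1 : MvPolynomial V k) ^ (T.filter (· < u)).card • resTo b T (T.erase u)) =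
          -((-1 : MvPolynomial V k) ^ ((insert v T).filter (· < v)).card •
            (-1 : MvPolynomial V k) ^ ((insert v T).filter (· < u)).card •
              resTo c (insert v T) ((insert v T).erase u)) := by
        intro u hu
        have huv : u ≠ v := fun h => hvT (h ▸ hu)
        have hsw := sign_swap (k := k) (Finset.mem_insert_of_mem hu) (Finset.mem_insert_self v T) huv
        rw [Finset.erase_insert hvT] at hsw
        have her : (insert v T).erase u = insert v (T.erase u) :=
          Finset.erase_insert_of_ne huv.symm
        rw [her, hfilter (T.erase u)] at hsw
        rw [map_smul, res_resTo b (T.erase_subset u), hresb _ _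
          (fun h => hvT (Finset.mem_of_mem_erase h))
          (Finset.insert_subset_insert v (T.erase_subset u)), her, smul_smul, smul_smul, ← neg_smul]
        congr 1
        set α := (-1 : MvPolynomial V k) ^ ((insert v T).filter (· < v)).card with hα
        set β := (-1 : MvPolynomial V k) ^ (T.filter (· < u)).card
        set γ := (-1 : MvPolynomial V k) ^ ((T.erase u).filter (· < v)).card
        set δ := (-1 : MvPolynomial V k) ^ ((insert v T).filter (· < u)).card
        have h3 : α * α = 1 := hsq _
        have h4 : γ * γ = 1 := hsq _
        calc β * γ = (α * α) * (β * γ) := by rw [h3, one_mul]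
          _ = α * γ * (α * β) := by ring
          _ = -(α * δ) * (γ * γ) := by rw [hsw]; ring
          _ = -(α * δ) := by rw [h4, mul_one]
      rw [Finset.sum_congr rfl h2, Finset.sum_neg_distrib, ← Finset.smul_sum,
        eq_neg_of_add_eq_zero_right hdc, smul_neg, neg_neg, smul_smul, hsq, one_smul]
  have hb_zero : ∀ S, c (insert v S) = 0 → b S = 0 := by
    intro S hS
    by_cases hv : v ∈ S
    · exact hb0 S hv
    · exact hJ.eq_zero_of_res_eq_zero hv hg (hbg S) (by rw [hbres S hv, hS, smul_zero])
  have hc0 := mem_cochains.1 hc.1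
  cases p with
  | zero =>
    have : b = 0 := funext fun S => hb_zero S (hc0 _ (by simp))
    rw [← hdb, this, map_zero]
    exact Submodule.zero_mem _
  | succ p =>
    refine ⟨b, mem_cochains.2 fun S hS => ?_, hdb⟩
    by_cases hv : v ∈ S
    · exact hb0 S hv
    · exact hb_zero S (hc0 _ (by rw [Finset.card_insert_of_notMem hv]; omega))

/-- The fine grading refines the standard one. -/
theorem fine_cech_eq_zero [Fintype V] (hJ1) (g : V → ℤ) (n : ℤ) (hgn : ∑ v, g v ≠ n)
    (c : Cech (V := V) k (MvPolynomial V k ⧸ J)) :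
    hJ.fine.cech g ((GradingProj.quotient (fun _ => (1 : ℤ)) J hJ1).cech n c) = 0 := by
  funext S
  rw [GradingProj.cech_apply, GradingProj.cech_apply, Pi.zero_apply]
  induction c S using LocalizedModule.induction_on with
  | _ m s =>
    obtain ⟨s, hs⟩ := s
    obtain ⟨b, hb, rfl⟩ := exists_eq_monomial hs
    obtain ⟨f, rfl⟩ := Ideal.Quotient.mk_surjective m
    rw [GradingProj.loc_mk, GradingProj.loc_mk, GradingProj.quotient_mk, fine,
      GradingProj.quotient_mk, weightedHomogeneousComponent_eq_zero', map_zero,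
      LocalizedModule.zero_mk]
    intro a ha h
    classical
    rw [mem_support_iff, coeff_weightedHomogeneousComponent] at ha
    have ha1 := (ite_ne_right_iff.1 ha).1
    rw [monWeight_monomial, GradingProj.weight_one_eq, GradingProj.weight_one_eq,
      Finsupp.degree_eq_sum, Finsupp.degree_eq_sum] at ha1
    rw [monWeight_monomial] at h
    have h1 : ∀ v, (a v : ℤ) = g v + b v := by
      intro v
      have := congrFun h v
      rwa [Pi.add_apply, weight_single_eq, weight_single_eq] at this
    push_cast at ha1
    simp_rw [h1] at ha1
    rw [Finset.sum_add_distrib] at ha1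
    exact hgn (add_right_cancel ha1)

/-- The class of a cocycle of fine degree `g` and standard degree `n ≥ 0` vanishes, unless
`n = 0` and `g = 0`. -/
theorem cls_cocyc_eq_zero [Fintype V] (hJ1) {n : ℤ} (hn : 0 ≤ n) {g : V → ℤ}
    (hg : 0 < n ∨ g ≠ 0) {p : ℕ} {u : cocycles (V := V) k (MvPolynomial V k ⧸ J) p}
    (hu : (GradingProj.quotient (fun _ => (1 : ℤ)) J hJ1).cocyc p n u = u) :
    cls p (hJ.fine.cocyc p g u) = 0 := by
  rw [cls_eq_zero]
  by_cases hv : ∃ v, 0 < g v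
  · obtain ⟨v, hv⟩ := hv
    exact hJ.mem_coboundaries_of_pos hv (hJ.fine.cocyc p g u).2 (hJ.fine.cech_idem g u)
  · push Not at hv
    have h1 : ∑ v, g v ≠ n := by
      intro h
      have h2 : ∑ v, g v ≤ 0 := Finset.sum_nonpos fun v _ => hv v
      rcases hg with hg | hg
      · omega
      · refine hg (funext fun v => ?_)
        exact (Finset.sum_eq_zero_iff_of_nonpos fun v _ => hv v).1 (by omega) v (Finset.mem_univ v)
    have h2 := hJ.fine_cech_eq_zero hJ1 g n h1 u
    have h3 : (GradingProj.quotient (fun _ => (1 : ℤ)) J hJ1).cech n u = u := congrArg Subtype.val hu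
    rw [h3] at h2
    change hJ.fine.cech g u ∈ _
    rw [h2]
    exact Submodule.zero_mem _

/-- Local cohomology of a squarefree monomial quotient vanishes in positive degrees. -/
theorem coh_eq_zero [Fintype V] (hJ : IsSquarefreeMonomial J) (hJ1) {n : ℤ} (hn : 0 < n) (p : ℕ)
    (x : LocalCoh (V := V) k (MvPolynomial V k ⧸ J) p) :
    ((GradingProj.quotient (fun _ => (1 : ℤ)) J hJ1).coh p).p n x = 0 := by
  set D := GradingProj.quotient (fun _ => (1 : ℤ)) J hJ1
  rw [← (D.coh p).idem]
  obtain ⟨u, rfl⟩ := cls_surjective p x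
  change (D.coh p).p n (cls p (D.cocyc p n u)) = 0
  set u' := D.cocyc p n u
  have hu' : D.cocyc p n u' = u' := Subtype.ext (D.cech_idem n u)
  change cls p (D.cocyc p n u') = 0
  rw [hu']
  obtain ⟨T, hT⟩ := (hJ.fine.coh p).exists_sum (cls p u')
  rw [← hT]
  exact Finset.sum_eq_zero fun g _ => hJ.cls_cocyc_eq_zero hJ1 hn.le (Or.inl hn) hu'

/-- In standard degree zero only the fine degree zero contributes. -/
theorem fine_coh_zero [Fintype V] (hJ1) (p : ℕ)
    (x : LocalCoh (V := V) k (MvPolynomial V k ⧸ J) p)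
    (hx : ((GradingProj.quotient (fun _ => (1 : ℤ)) J hJ1).coh p).p 0 x = x) :
    (hJ.fine.coh p).p 0 x = x := by
  set D := GradingProj.quotient (fun _ => (1 : ℤ)) J hJ1
  obtain ⟨u, rfl⟩ := cls_surjective p x
  rw [← hx]
  change (hJ.fine.coh p).p 0 (cls p (D.cocyc p 0 u)) = cls p (D.cocyc p 0 u)
  set u' := D.cocyc p 0 u
  have hu' : D.cocyc p 0 u' = u' := Subtype.ext (D.cech_idem 0 u)
  obtain ⟨T, hT⟩ := (hJ.fine.coh p).exists_sum (cls p u')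
  have h0 : ∀ g ≠ 0, (hJ.fine.coh p).p g (cls p u') = 0 := fun g hg =>
    hJ.cls_cocyc_eq_zero hJ1 le_rfl (Or.inr hg) hu'
  conv_rhs => rw [← hT]
  by_cases h : (0 : V → ℤ) ∈ T
  · rw [Finset.sum_eq_single_of_mem 0 h fun g _ hg => h0 g hg]
  · rw [Finset.sum_eq_zero fun g hg => h0 g (by rintro rfl; exact h hg)]
    rw [← hT, Finset.sum_eq_zero fun g hg => h0 g (by rintro rfl; exact h hg), map_zero]

/-- Local cohomology of a squarefree monomial quotient is finite-dimensional in degree zero, since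
each localization has at most a one-dimensional component of fine degree zero. -/
theorem finite_of_coh_zero [Fintype V] (hJ : IsSquarefreeMonomial J) (hJ1) (p : ℕ)
    (W : Submodule k (LocalCoh (V := V) k (MvPolynomial V k ⧸ J) p))
    (hW : ∀ x ∈ W, ((GradingProj.quotient (fun _ => (1 : ℤ)) J hJ1).coh p).p 0 x = x) :
    Module.Finite k W := by
  let ι : (Finset V → k) →ₗ[k] Cech (V := V) k (MvPolynomial V k ⧸ J) :=
    LinearMap.pi fun S => (LinearMap.toSpanSingleton k _
      (LocalizedModule.mk (1 : MvPolynomial V k ⧸ J) (1 : monomialsOn k S) :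
        Loc k (MvPolynomial V k ⧸ J) S)) ∘ₗ LinearMap.proj S
  have hι : ∀ c, hJ.fine.cech 0 c ∈ LinearMap.range ι := by
    intro c
    have hS : ∀ S : Finset V, ∃ a : k, a • (LocalizedModule.mk (1 : MvPolynomial V k ⧸ J)
        (1 : monomialsOn k S) : Loc k (MvPolynomial V k ⧸ J) S) = hJ.fine.cech 0 c S := by
      intro S
      obtain ⟨b, hb, x, hx, rfl | ⟨a, r, ha, rfl⟩⟩ :=
        hJ.exists_eq_mk (hJ.fine.loc_idem S 0 (c S))
      · exact ⟨0, by rw [zero_smul, hJ.fine.cech_apply, hx, LocalizedModule.zero_mk]⟩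
      · have hab : a = b := by
          ext v
          have := ha v
          rw [Pi.zero_apply, zero_add] at this
          exact_mod_cast this
        subst hab
        refine ⟨r, ?_⟩
        rw [hJ.fine.cech_apply, hx, GradingProj.mk_k_smul, LocalizedModule.mk_eq]
        refine ⟨1, ?_⟩
        rw [one_smul, one_smul, one_smul, Submonoid.smul_def]
        change Ideal.Quotient.mk J (monomial a 1 * (r • 1)) = Ideal.Quotient.mk J (monomial a r)
        rw [mul_smul_comm, mul_one, smul_monomial, smul_eq_mul, mul_one]
    choose a ha using hS
    exact ⟨a, funext ha⟩
  let R : Submodule k (cocycles (V := V) k (MvPolynomial V k ⧸ J) p) :=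
    (LinearMap.range ι).comap ((cocycles (V := V) k _ p).subtype.restrictScalars k)
  have hR : Module.Finite k R := by
    let j : R →ₗ[k] LinearMap.range ι :=
      ((cocycles (V := V) k _ p).subtype.restrictScalars k).restrict fun _ hx => hx
    refine Module.Finite.of_injective j fun x y hxy => ?_
    have h : (j x).1 = (j y).1 := by rw [hxy]
    exact Subtype.ext (Subtype.ext h)
  have hle : W ≤ R.map ((cls p).restrictScalars k) := by
    intro x hx
    rw [← hJ.fine_coh_zero hJ1 p x (hW x hx)]
    obtain ⟨u, rfl⟩ := cls_surjective p x
    exact ⟨hJ.fine.cocyc p 0 u, hι u, rfl⟩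
  exact Submodule.finiteDimensional_of_le hle

end IsSquarefreeMonomial

/-! ### Truncations and the graded isomorphism -/

section Trunc

variable {k V : Type*} [Field k]
variable {M : Type*} [AddCommGroup M] [Module k M] [Module (MvPolynomial V k) M]

theorem mem_truncGE_of_mem {𝓜 : ℤ → Submodule k M} {n m : ℤ} (h : n ≤ m) {x : M} (hx : x ∈ 𝓜 m) :
    x ∈ truncGE (V := V) 𝓜 n :=
  Submodule.subset_span ⟨m, h, hx⟩

theorem GradingProj.X_smul_mem {D : GradingProj (k := k) (V := V) (fun _ => (1 : ℤ)) M}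
    {m : ℤ} (v : V) {x : M} (hx : D.p m x = x) :
    D.p (m + 1) ((X v : MvPolynomial V k) • x) = (X v : MvPolynomial V k) • x :=
  (D.X_smul m v x).trans (by rw [hx])

theorem GradingProj.p_eq_zero {D : GradingProj (k := k) (V := V) (fun _ => (1 : ℤ)) M}
    {m n : ℤ} (hmn : m ≠ n) {x : M} (hx : D.p n x = x) : D.p m x = 0 := by
  rw [← hx, D.orth _ _ _ hmn]

variable [IsScalarTower k (MvPolynomial V k) M]

/-- When only the components of degree `n` and `n + 1` survive, the truncation is their sum. -/
theorem exists_add_of_mem_truncGE {𝓜 : ℤ → Submodule k M} {n : ℤ}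
    (hX : ∀ m (v : V), ∀ x ∈ 𝓜 m, (X v : MvPolynomial V k) • x ∈ 𝓜 (m + 1))
    (htop : ∀ m, n + 1 < m → ∀ x ∈ 𝓜 m, x = 0) {x : M} (hx : x ∈ truncGE (V := V) 𝓜 n) :
    ∃ a ∈ 𝓜 n, ∃ b ∈ 𝓜 (n + 1), x = a + b := by
  induction hx using Submodule.span_induction with
  | mem x hx =>
    obtain ⟨m, hm, hx⟩ := hx
    obtain rfl | hm := hm.eq_or_lt
    · exact ⟨x, hx, 0, Submodule.zero_mem _, (add_zero x).symm⟩
    obtain rfl | hm := (Int.add_one_le_iff.2 hm).eq_or_lt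
    · exact ⟨0, Submodule.zero_mem _, x, hx, (zero_add x).symm⟩
    · exact ⟨0, Submodule.zero_mem _, 0, Submodule.zero_mem _, by rw [htop m hm x hx, add_zero]⟩
  | zero => exact ⟨0, Submodule.zero_mem _, 0, Submodule.zero_mem _, (add_zero 0).symm⟩
  | add x y _ _ hx hy =>
    obtain ⟨a, ha, b, hb, rfl⟩ := hx
    obtain ⟨a', ha', b', hb', rfl⟩ := hy
    exact ⟨_, Submodule.add_mem _ ha ha', _, Submodule.add_mem _ hb hb', add_add_add_comm a b a' b'⟩
  | smul f x _ hx =>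
    induction f using MvPolynomial.induction_on with
    | C c =>
      obtain ⟨a, ha, b, hb, rfl⟩ := hx
      refine ⟨_, Submodule.smul_mem _ c ha, _, Submodule.smul_mem _ c hb, ?_⟩
      rw [← algebraMap_eq, algebraMap_smul, smul_add]
    | add p q hp hq =>
      obtain ⟨a, ha, b, hb, h⟩ := hp
      obtain ⟨a', ha', b', hb', h'⟩ := hq
      exact ⟨_, Submodule.add_mem _ ha ha', _, Submodule.add_mem _ hb hb', by
        rw [add_smul, h, h', add_add_add_comm]⟩
    | mul_X p v hp =>
      obtain ⟨a, ha, b, hb, h⟩ := hp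
      refine ⟨0, Submodule.zero_mem _, _, hX n v a ha, ?_⟩
      rw [mul_comm, mul_smul, h, smul_add, htop _ (by omega) _ (hX (n + 1) v b hb), zero_add,
        add_zero]

variable {N : Type*} [AddCommGroup N] [Module k N] [Module (MvPolynomial V k) N]
variable [IsScalarTower k (MvPolynomial V k) N]
variable (D : GradingProj (k := k) (V := V) (fun _ => (1 : ℤ)) M)
variable (E : GradingProj (k := k) (V := V) (fun _ => (1 : ℤ)) N)

/-- A homomorphism `φ : M → N` of graded modules that lowers degrees by `j`, where `M` vanishes
above degree `j` and `N` above degree `0`, induces an isomorphism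
`(K / B)_{≥ j - 1} ≅ (Ann)_{≥ -1}` as soon as it does so in the two degrees concerned. -/
theorem exists_truncGE_equiv {𝓜 : ℤ → Submodule k M} {𝓝 : ℤ → Submodule k N}
    (h𝓜 : ∀ n m, m ∈ 𝓜 n ↔ D.p n m = m) (h𝓝 : ∀ n m, m ∈ 𝓝 n ↔ E.p n m = m)
    (φ : M →ₗ[MvPolynomial V k] N) (j : ℤ)
    (hφ : ∀ m x, φ (D.p m x) = E.p (m - j) (φ x))
    (htopM : ∀ m, j < m → ∀ x, D.p m x = 0) (htopN : ∀ m, 0 < m → ∀ y, E.p m y = 0)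
    (hinj : ∀ x, D.p j x = x → φ x = 0 → x = 0)
    (K B : Submodule (MvPolynomial V k) M) (hB : ∀ b, b ∈ B ↔ D.p (j - 1) b = b ∧ φ b = 0)
    (Ann : Submodule (MvPolynomial V k) N) (hAnn : ∀ m, ∀ y ∈ Ann, E.p m y ∈ Ann)
    (hφK : ∀ a ∈ K, φ a ∈ Ann)
    (hsurj : ∀ y ∈ Ann, E.p (-1) y = y → ∃ a ∈ K, D.p (j - 1) a = a ∧ φ a = y)
    (hsurj0 : ∀ y, E.p 0 y = y → ∃ a ∈ K, D.p j a = a ∧ φ a = y) :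
    ∃ e : truncGE (V := V) (subquotientDeg 𝓜 K B) (j - 1) ≃ₗ[MvPolynomial V k]
        (truncGE 𝓝 (-1) ⊓ Ann : Submodule (MvPolynomial V k) N),
      (∀ n : ℤ, ∀ x, x.1 ∈ subquotientDeg 𝓜 K B n ↔ (e x : N) ∈ 𝓝 (n - j)) ∧
      ∀ (x : K) (hx : (B.submoduleOf K).mkQ x ∈ truncGE (V := V) (subquotientDeg 𝓜 K B) (j - 1)),
        (e ⟨_, hx⟩ : N) = φ x := by
  let ψ : (K ⧸ B.submoduleOf K) →ₗ[MvPolynomial V k] N :=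
    (B.submoduleOf K).liftQ (φ ∘ₗ K.subtype) fun b hb => ((hB b).1 hb).2
  have hψ : ∀ a : K, ψ ((B.submoduleOf K).mkQ a) = φ a := fun a => rfl
  set T := truncGE (V := V) (subquotientDeg 𝓜 K B) (j - 1)
  have hT : ∀ x ∈ T, ∃ a b : K, D.p (j - 1) (a : M) = a ∧ D.p j (b : M) = b ∧
      x = (B.submoduleOf K).mkQ a + (B.submoduleOf K).mkQ b := by
    intro x hx
    have hXT : ∀ m (v : V), ∀ x ∈ subquotientDeg 𝓜 K B m,
        (X v : MvPolynomial V k) • x ∈ subquotientDeg 𝓜 K B (m + 1) := by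
      rintro m v _ ⟨a, ha, rfl⟩
      refine ⟨(X v : MvPolynomial V k) • a, ?_, map_smul (B.submoduleOf K).mkQ _ a⟩
      exact (h𝓜 _ _).2 (GradingProj.X_smul_mem v ((h𝓜 _ _).1 ha))
    have htopT : ∀ m, j - 1 + 1 < m → ∀ x ∈ subquotientDeg 𝓜 K B m, x = 0 := by
      rintro m hm _ ⟨a, ha, rfl⟩
      have h0 : a = 0 := by
        refine Subtype.ext (((h𝓜 _ _).1 ha).symm.trans ?_)
        exact htopM m (by omega) _
      rw [h0, map_zero]
    obtain ⟨_, ⟨a, ha, rfl⟩, _, ⟨b, hb, rfl⟩, rfl⟩ := exists_add_of_mem_truncGE hXT htopT hx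
    refine ⟨a, b, (h𝓜 _ _).1 ha, ?_, rfl⟩
    have := (h𝓜 _ _).1 hb
    rwa [sub_add_cancel] at this
  have hφj : ∀ {m : ℤ} {a : M}, D.p m a = a → E.p (m - j) (φ a) = φ a := by
    intro m a ha
    rw [← hφ, ha]
  have hφa : ∀ {a : M}, D.p (j - 1) a = a → E.p (-1) (φ a) = φ a := by
    intro a ha
    have := hφj ha
    rwa [show j - 1 - j = -1 by ring] at this
  have hφb : ∀ {b : M}, D.p j b = b → E.p 0 (φ b) = φ b := by
    intro b hb
    have := hφj hb
    rwa [sub_self] at this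
  have hpa : ∀ {a b : M}, D.p (j - 1) a = a → D.p j b = b → E.p (-1) (φ a + φ b) = φ a := by
    intro a b ha hb
    rw [map_add, hφa ha, GradingProj.p_eq_zero (by decide) (hφb hb), add_zero]
  have hpb : ∀ {a b : M}, D.p (j - 1) a = a → D.p j b = b → E.p 0 (φ a + φ b) = φ b := by
    intro a b ha hb
    rw [map_add, hφb hb, GradingProj.p_eq_zero (by decide) (hφa ha), zero_add]
  have hmkB : ∀ a : K, D.p (j - 1) (a : M) = a → φ a = 0 → (B.submoduleOf K).mkQ a = 0 := by
    intro a ha h0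
    rw [Submodule.mkQ_apply, Submodule.Quotient.mk_eq_zero]
    exact (hB a).2 ⟨ha, h0⟩
  have hmem : ∀ x : T, ψ x ∈ (truncGE 𝓝 (-1) ⊓ Ann : Submodule (MvPolynomial V k) N) := by
    rintro ⟨x, hx⟩
    obtain ⟨a, b, ha, hb, rfl⟩ := hT x hx
    simp only [map_add, hψ]
    refine ⟨Submodule.add_mem _ (mem_truncGE_of_mem le_rfl ((h𝓝 _ _).2 (hφa ha)))
      (mem_truncGE_of_mem (by decide) ((h𝓝 0 _).2 (hφb hb))),
      Submodule.add_mem _ (hφK a a.2) (hφK b b.2)⟩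
  let e₀ : T →ₗ[MvPolynomial V k] (truncGE 𝓝 (-1) ⊓ Ann : Submodule (MvPolynomial V k) N) :=
    (ψ ∘ₗ T.subtype).codRestrict _ hmem
  have he₀ : ∀ x : T, (e₀ x : N) = ψ x := fun x => rfl
  have hbij : Function.Bijective e₀ := by
    constructor
    · refine (injective_iff_map_eq_zero e₀).2 ?_
      rintro ⟨x, hx⟩ h0
      obtain ⟨a, b, ha, hb, rfl⟩ := hT x hx
      have h1 : φ a + φ b = 0 := by
        have := congrArg Subtype.val h0
        rwa [he₀, map_add, hψ, hψ] at this
      have h2 : φ a = 0 := by rw [← hpa ha hb, h1, map_zero]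
      have h3 : φ b = 0 := by rw [← hpb ha hb, h1, map_zero]
      have h4 : b = 0 := Subtype.ext (hinj b hb h3)
      refine Subtype.ext ?_
      change (B.submoduleOf K).mkQ a + (B.submoduleOf K).mkQ b = 0
      rw [hmkB a ha h2, h4, map_zero, add_zero]
    · rintro ⟨y, hy, hyA⟩
      obtain ⟨a, ha, b, hb, rfl⟩ := exists_add_of_mem_truncGE (V := V) (𝓜 := 𝓝) (n := -1)
        (fun m v x hx => (h𝓝 _ _).2 (GradingProj.X_smul_mem v ((h𝓝 _ _).1 hx)))
        (fun m hm x hx => by rw [← (h𝓝 _ _).1 hx, htopN m (by omega)]) hy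
      rw [neg_add_cancel] at hb
      have ha' := (h𝓝 _ _).1 ha
      have hb' := (h𝓝 _ _).1 hb
      have haA : a ∈ Ann := by
        have := hAnn (-1) _ hyA
        rwa [map_add, ha', GradingProj.p_eq_zero (by decide) hb', add_zero] at this
      obtain ⟨a', haK, haj, rfl⟩ := hsurj a haA ha'
      obtain ⟨b', hbK, hbj, rfl⟩ := hsurj0 b hb'
      refine ⟨⟨(B.submoduleOf K).mkQ ⟨a', haK⟩ + (B.submoduleOf K).mkQ ⟨b', hbK⟩,
        Submodule.add_mem _ (mem_truncGE_of_mem le_rfl ⟨⟨a', haK⟩, (h𝓜 _ _).2 haj, rfl⟩)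
          (mem_truncGE_of_mem (m := j) (by omega) ⟨⟨b', hbK⟩, (h𝓜 _ _).2 hbj, rfl⟩)⟩,
        Subtype.ext ?_⟩
      rw [he₀, map_add, hψ, hψ]
  refine ⟨LinearEquiv.ofBijective e₀ hbij, ?_, fun x hx => rfl⟩
  rintro n ⟨x, hx⟩
  change x ∈ _ ↔ ψ x ∈ 𝓝 (n - j)
  constructor
  · rintro ⟨a, ha, rfl⟩
    exact (h𝓝 _ _).2 (hφj ((h𝓜 _ _).1 ha))
  · intro hn
    obtain ⟨a, b, ha, hb, rfl⟩ := hT x hx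
    rw [map_add, hψ, hψ, h𝓝] at hn
    have h1 : n - j ≠ -1 → (B.submoduleOf K).mkQ a = 0 := fun h =>
      hmkB a ha (by rw [← hpa ha hb, GradingProj.p_eq_zero h.symm hn])
    have h2 : n - j ≠ 0 → b = 0 := fun h => Subtype.ext
      (hinj b hb (by rw [← hpb ha hb, GradingProj.p_eq_zero h.symm hn]))
    by_cases h3 : n = j
    · rw [h1 (by omega), zero_add, h3]
      exact ⟨b, (h𝓜 _ _).2 hb, rfl⟩
    · rw [h2 (by omega), map_zero, add_zero]
      by_cases h4 : n = j - 1
      · rw [h4]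
        exact ⟨a, (h𝓜 _ _).2 ha, rfl⟩
      · rw [h1 (by omega)]
        exact Submodule.zero_mem _

end Trunc

/-! ### Iterated connecting homomorphisms in the top two degrees -/

/-- The data extracted from the long exact sequences: graded modules `H i s` (in the application
`M^i(s)`), operators `θ s`, and for each `s < d` an exact sequence
`H i s → H i s → H i (s+1) → H (i+1) s → H (i+1) s` given by `θ s`, `proj`, `δ` and `θ s`, where
`θ` raises degrees by one, `δ` lowers them by one, and `H i 0` vanishes in positive degrees. -/
structure ConnectingTower (k V : Type*) [Field k] (d : ℕ) (θ : ℕ → MvPolynomial V k)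
    (H : ℕ → ℕ → Type*) [∀ i s, AddCommGroup (H i s)] [∀ i s, Module k (H i s)]
    [∀ i s, Module (MvPolynomial V k) (H i s)]
    [∀ i s, IsScalarTower k (MvPolynomial V k) (H i s)] where
  D : ∀ i s, GradingProj (k := k) (V := V) (fun _ => (1 : ℤ)) (H i s)
  proj : ∀ i s, H i s →ₗ[MvPolynomial V k] H i (s + 1)
  δ : ∀ i s, H i (s + 1) →ₗ[MvPolynomial V k] H (i + 1) s
  D_smul : ∀ i s s' n x, (D i s).p (n + 1) (θ s' • x) = θ s' • (D i s).p n x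
  D_proj : ∀ i s n x, proj i s ((D i s).p n x) = (D i (s + 1)).p n (proj i s x)
  D_δ : ∀ i s n x, s < d → δ i s ((D i (s + 1)).p (n + 1) x) = (D (i + 1) s).p n (δ i s x)
  proj_smul : ∀ i s x, s < d → proj i s (θ s • x) = 0
  exists_smul_eq : ∀ i s x, s < d → proj i s x = 0 → ∃ y, θ s • y = x
  δ_proj : ∀ i s x, s < d → δ i s (proj i s x) = 0
  exists_proj_eq : ∀ i s x, s < d → δ i s x = 0 → ∃ y, proj i s y = x
  smul_δ : ∀ i s x, s < d → θ s • δ i s x = 0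
  exists_δ_eq : ∀ i s x, s < d → θ s • x = 0 → ∃ y, δ i s y = x
  top : ∀ i n x, 0 < n → (D i 0).p n x = 0

namespace ConnectingTower

variable {k V : Type*} [Field k] {d : ℕ} {θ : ℕ → MvPolynomial V k}
variable {H : ℕ → ℕ → Type*} [∀ i s, AddCommGroup (H i s)] [∀ i s, Module k (H i s)]
variable [∀ i s, Module (MvPolynomial V k) (H i s)]
variable [∀ i s, IsScalarTower k (MvPolynomial V k) (H i s)]
variable (C : ConnectingTower k V d θ H)

/-- The iterated connecting homomorphism `H i s → H n 0`, for `n = i + s`. -/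
def phi : (s i n : ℕ) → i + s = n → (H i s →ₗ[MvPolynomial V k] H n 0)
  | 0, i, _, h => h ▸ (LinearMap.id : H i 0 →ₗ[MvPolynomial V k] H i 0)
  | s + 1, i, n, h => phi s (i + 1) n (by omega) ∘ₗ C.δ i s

theorem phi_zero (i : ℕ) (h : i + 0 = i) (x : H i 0) : C.phi 0 i i h x = x := by
  rw [phi]
  rfl

theorem phi_succ (s i n : ℕ) (h : i + (s + 1) = n) (x : H i (s + 1)) :
    C.phi (s + 1) i n h x = C.phi s (i + 1) n (by omega) (C.δ i s x) := by
  rw [phi]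
  rfl

theorem D_δ' {s : ℕ} (hs : s < d) (i : ℕ) (n : ℤ) (x : H i (s + 1)) :
    C.δ i s ((C.D i (s + 1)).p n x) = (C.D (i + 1) s).p (n - 1) (C.δ i s x) := by
  rw [← C.D_δ i s _ x hs, sub_add_cancel]

theorem D_smul_eq {i s s' : ℕ} {n : ℤ} {x : H i s} (hx : (C.D i s).p (n - 1) x = x) :
    (C.D i s).p n (θ s' • x) = θ s' • x := by
  have := C.D_smul i s s' (n - 1) x
  rwa [sub_add_cancel, hx] at this

theorem phi_D {s : ℕ} (hs : s ≤ d) (i n : ℕ) (h : i + s = n) (m : ℤ) (x : H i s) :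
    C.phi s i n h ((C.D i s).p m x) = (C.D n 0).p (m - s) (C.phi s i n h x) := by
  induction s generalizing i m with
  | zero =>
    obtain rfl : i = n := h
    rw [Nat.cast_zero, sub_zero, phi_zero, phi_zero]
  | succ s ih =>
    rw [phi_succ, phi_succ, C.D_δ' (by omega), ih (by omega)]
    congr 2
    push_cast
    ring

/-- An element of degree `n` killed by `δ` comes from degree `n`. -/
theorem exists_proj_eq_of_degree {i s : ℕ} (hs : s < d) {n : ℤ} {x : H i (s + 1)}
    (hx : (C.D i (s + 1)).p n x = x) (h0 : C.δ i s x = 0) :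
    ∃ y, (C.D i s).p n y = y ∧ C.proj i s y = x := by
  obtain ⟨y, rfl⟩ := C.exists_proj_eq i s x hs h0
  exact ⟨(C.D i s).p n y, (C.D i s).idem n y, by rw [C.D_proj, hx]⟩

theorem exists_δ_eq_of_degree {i s : ℕ} (hs : s < d) {n : ℤ} {x : H (i + 1) s}
    (hx : (C.D (i + 1) s).p (n - 1) x = x) (h0 : θ s • x = 0) :
    ∃ y, (C.D i (s + 1)).p n y = y ∧ C.δ i s y = x := by
  obtain ⟨y, rfl⟩ := C.exists_δ_eq i s x hs h0
  exact ⟨(C.D i (s + 1)).p n y, (C.D i (s + 1)).idem n y, by rw [C.D_δ' hs, hx]⟩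

theorem exists_smul_eq_of_degree {i s : ℕ} (hs : s < d) {n : ℤ} {x : H i s}
    (hx : (C.D i s).p n x = x) (h0 : C.proj i s x = 0) :
    ∃ y, (C.D i s).p (n - 1) y = y ∧ θ s • y = x := by
  obtain ⟨y, rfl⟩ := C.exists_smul_eq i s x hs h0
  refine ⟨(C.D i s).p (n - 1) y, (C.D i s).idem _ y, ?_⟩
  rw [← C.D_smul, sub_add_cancel, hx]

/-- `H i s` vanishes above degree `s`. -/
theorem D_eq_zero {s : ℕ} (hs : s ≤ d) (i : ℕ) {m : ℤ} (hm : (s : ℤ) < m) (x : H i s) :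
    (C.D i s).p m x = 0 := by
  induction s generalizing i m with
  | zero => exact C.top i m x (by exact_mod_cast hm)
  | succ s ih =>
    push_cast at hm
    obtain ⟨y, hy, hyx⟩ := C.exists_proj_eq_of_degree (n := m) (x := (C.D i (s + 1)).p m x)
      (by omega) ((C.D i (s + 1)).idem m x)
      (by rw [C.D_δ' (by omega), ih (by omega) (i + 1) (by omega)])
    rw [← hyx, ← hy, ih (by omega) i (by omega), map_zero]

theorem eq_zero_of_degree {s : ℕ} (hs : s ≤ d) {i : ℕ} {m : ℤ} (hm : (s : ℤ) < m) {x : H i s}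
    (hx : (C.D i s).p m x = x) : x = 0 := by
  rw [← hx, C.D_eq_zero hs i hm]

theorem smul_phi {s : ℕ} (hs : s ≤ d) (i n : ℕ) (h : i + s = n) (x : H i s) {p : ℕ} (hp : p < s) :
    θ p • C.phi s i n h x = 0 := by
  induction s generalizing i with
  | zero => omega
  | succ s ih =>
    rw [phi_succ]
    by_cases hps : p = s
    · rw [← map_smul, hps, C.smul_δ i s x (by omega), map_zero]
    · exact ih (by omega) (i + 1) (by omega) _ (by omega)

/-- In the top degree `s` the iterated connecting homomorphism is injective. -/
theorem eq_zero_of_phi {s : ℕ} (hs : s ≤ d) (i n : ℕ) (h : i + s = n) {x : H i s}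
    (hx : (C.D i s).p s x = x) (h0 : C.phi s i n h x = 0) : x = 0 := by
  induction s generalizing i with
  | zero =>
    obtain rfl : i = n := h
    rwa [phi_zero] at h0
  | succ s ih =>
    rw [phi_succ] at h0
    have h1 : C.δ i s x = 0 := by
      refine ih (by omega) (i + 1) (by omega) ?_ h0
      conv_rhs => rw [← hx, C.D_δ' (by omega)]
      push_cast
      rw [add_sub_cancel_right]
    obtain ⟨y, hy, rfl⟩ := C.exists_proj_eq_of_degree (by omega) hx h1
    rw [C.eq_zero_of_degree (by omega) (by push_cast; omega) hy, map_zero]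

/-- In the top degree `s` the iterated connecting homomorphism is surjective. -/
theorem exists_phi_eq_top {s : ℕ} (hs : s ≤ d) (i n : ℕ) (h : i + s = n) {y : H n 0}
    (hy : (C.D n 0).p 0 y = y) : ∃ x, (C.D i s).p s x = x ∧ C.phi s i n h x = y := by
  induction s generalizing i with
  | zero =>
    obtain rfl : i = n := h
    exact ⟨y, hy, C.phi_zero i rfl y⟩
  | succ s ih =>
    obtain ⟨x, hx, hxy⟩ := ih (by omega) (i + 1) (by omega)
    have h0 : θ s • x = 0 := C.eq_zero_of_degree (m := s + 1) (by omega) (by omega)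
      (C.D_smul_eq (by rwa [add_sub_cancel_right]))
    obtain ⟨x', hx', rfl⟩ := C.exists_δ_eq_of_degree (n := s + 1) (by omega)
      (by rwa [add_sub_cancel_right]) h0
    exact ⟨x', by push_cast; exact hx', (C.phi_succ s i n h x').trans hxy⟩

/-- In degree `s - 1` the iterated connecting homomorphism maps onto the elements of degree `-1`
annihilated by `θ 0, …, θ (s - 1)`. -/
theorem exists_phi_eq_of_smul {s : ℕ} (hs : s ≤ d) (i n : ℕ) (h : i + s = n) {y : H n 0}
    (hy : (C.D n 0).p (-1) y = y) (hθ : ∀ p < s, θ p • y = 0) :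
    ∃ x, (C.D i s).p (s - 1) x = x ∧ C.phi s i n h x = y := by
  induction s generalizing i with
  | zero =>
    obtain rfl : i = n := h
    exact ⟨y, by rwa [Nat.cast_zero, zero_sub], C.phi_zero i rfl y⟩
  | succ s ih =>
    obtain ⟨x, hx, hxy⟩ := ih (by omega) (i + 1) (by omega) fun p hp => hθ p (by omega)
    have h0 : θ s • x = 0 := by
      refine C.eq_zero_of_phi (by omega) (i + 1) n (by omega) (C.D_smul_eq hx) ?_
      rw [map_smul, hxy, hθ s (by omega)]
    obtain ⟨x', hx', rfl⟩ := C.exists_δ_eq_of_degree (n := s) (by omega) hx h0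
    exact ⟨x', by push_cast; rwa [add_sub_cancel_right], (C.phi_succ s i n h x').trans hxy⟩

/-- The elements of degree `s - 1` killed by the iterated connecting homomorphism. -/
def B (s i n : ℕ) (h : i + s = n) : Submodule k (H i s) where
  carrier := {x | (C.D i s).p (s - 1) x = x ∧ C.phi s i n h x = 0}
  add_mem' hx hy := ⟨by rw [map_add, hx.1, hy.1], by rw [map_add, hx.2, hy.2, add_zero]⟩
  zero_mem' := ⟨map_zero _, map_zero _⟩
  smul_mem' c x hx := ⟨by rw [map_smul, hx.1], by
    rw [← algebraMap_smul (MvPolynomial V k) c x, map_smul, hx.2, smul_zero]⟩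

/-- The recursion for `B`: there is an exact sequence
`0 → (H n 0)_0 / θ_s L → B (s+1) i → B s (i+1) → 0`, where `n = i + s` and `L` consists of the
elements of degree `-1` of `H n 0` that are annihilated by `θ 0, …, θ (s - 1)`. The first map is
induced by `proj`, after the identification of `(H n 0)_0` with the top degree of `H i s`. -/
theorem finite_and_finrank_B_succ {s : ℕ} (hs : s < d) (i n n' : ℕ) (h : i + s = n)
    (h' : i + (s + 1) = n') (Z W : Submodule k (H n 0))
    (hZ : ∀ y, y ∈ Z ↔ (C.D n 0).p 0 y = y) [Module.Finite k Z]
    (hW : ∀ y ∈ Z, y ∈ W ↔ ∃ y', (C.D n 0).p (-1) y' = y' ∧ (∀ p < s, θ p • y' = 0) ∧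
      θ s • y' = y)
    (hfin : Module.Finite k (C.B s (i + 1) n' (by omega))) :
    Module.Finite k (C.B (s + 1) i n' h') ∧ Module.finrank k (C.B (s + 1) i n' h') =
      Module.finrank k (C.B s (i + 1) n' (by omega)) + Module.finrank k (Z ⧸ W.submoduleOf Z) := by
  set B₁ := C.B (s + 1) i n' h'
  set B₂ := C.B s (i + 1) n' (by omega)
  let δk : H i (s + 1) →ₗ[k] H (i + 1) s := (C.δ i s).restrictScalars k
  let g : B₁ →ₗ[k] B₂ := δk.restrict (by
    rintro x ⟨hx, hx0⟩
    refine ⟨?_, (C.phi_succ s i n' h' x).symm.trans hx0⟩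
    change (C.D (i + 1) s).p (s - 1) (C.δ i s x) = C.δ i s x
    conv_rhs => rw [← hx, C.D_δ' hs]
    push_cast
    rw [add_sub_cancel_right])
  have hg : Function.Surjective g := by
    rintro ⟨b, hb, hb0⟩
    have h0 : θ s • b = 0 := by
      refine C.eq_zero_of_phi hs.le (i + 1) n' (by omega) (C.D_smul_eq hb) ?_
      rw [map_smul, hb0, smul_zero]
    obtain ⟨x, hx, rfl⟩ := C.exists_δ_eq_of_degree hs hb h0
    exact ⟨⟨x, by push_cast; rwa [add_sub_cancel_right], (C.phi_succ s i n' h' x).trans hb0⟩, rfl⟩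
  let P : Submodule k (H i s) := LinearMap.range ((C.D i s).p s)
  have hP : ∀ x : P, (C.D i s).p s (x : H i s) = x := by
    rintro ⟨_, x, rfl⟩
    exact (C.D i s).idem s x
  let projk : H i s →ₗ[k] H i (s + 1) := (C.proj i s).restrictScalars k
  let q : P →ₗ[k] B₁ := (projk ∘ₗ P.subtype).codRestrict B₁ (by
    intro x
    refine ⟨?_, ?_⟩
    · change (C.D i (s + 1)).p _ (C.proj i s x) = C.proj i s x
      rw [← C.D_proj]
      push_cast
      rw [add_sub_cancel_right, hP]
    · change C.phi (s + 1) i n' h' (C.proj i s x) = 0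
      rw [phi_succ, C.δ_proj i s _ hs, map_zero])
  let phik : H i s →ₗ[k] H n 0 := (C.phi s i n h).restrictScalars k
  let r₀ : P →ₗ[k] Z := phik.restrict (by
    rintro x hx
    rw [hZ]
    change (C.D n 0).p 0 (C.phi s i n h x) = C.phi s i n h x
    have h1 := C.phi_D hs.le i n h s x
    rwa [sub_self, hP ⟨x, hx⟩, eq_comm] at h1)
  have hr₀ : Function.Surjective r₀ := by
    rintro ⟨y, hy⟩
    obtain ⟨x, hx, rfl⟩ := C.exists_phi_eq_top hs.le i n h ((hZ y).1 hy)
    exact ⟨⟨x, x, hx⟩, rfl⟩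
  let r : P →ₗ[k] Z ⧸ W.submoduleOf Z := (W.submoduleOf Z).mkQ ∘ₗ r₀
  have hr : Function.Surjective r := (Submodule.mkQ_surjective _).comp hr₀
  have hker : LinearMap.ker q = LinearMap.ker r := by
    ext x
    have h1 : x ∈ LinearMap.ker q ↔ C.proj i s x = 0 := by
      rw [LinearMap.mem_ker, Subtype.ext_iff]
      rfl
    have h2 : x ∈ LinearMap.ker r ↔ C.phi s i n h x ∈ W := by
      rw [LinearMap.mem_ker, LinearMap.comp_apply, Submodule.mkQ_apply,
        Submodule.Quotient.mk_eq_zero]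
      rfl
    rw [h1, h2, show C.phi s i n h x ∈ W ↔ _ from hW _ (r₀ x).2]
    constructor
    · intro h0
      obtain ⟨x', hx', hxx'⟩ := C.exists_smul_eq_of_degree hs (hP x) h0
      refine ⟨C.phi s i n h x', ?_, fun p hp => C.smul_phi hs.le i n h x' hp, ?_⟩
      · have h3 := C.phi_D hs.le i n h (s - 1) x'
        rwa [hx', show (s : ℤ) - 1 - s = -1 by ring, eq_comm] at h3
      · rw [← map_smul, hxx']
    · rintro ⟨y', hy', hθ, hy⟩
      obtain ⟨x', hx', rfl⟩ := C.exists_phi_eq_of_smul hs.le i n h hy' hθ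
      have h3 : θ s • x' = x := by
        refine sub_eq_zero.1 (C.eq_zero_of_phi hs.le i n h ?_ ?_)
        · rw [map_sub, C.D_smul_eq hx', hP]
        · rw [map_sub, map_smul, hy]
          exact sub_self _
      rw [← h3, C.proj_smul i s _ hs]
  have hrange : LinearMap.range q = LinearMap.ker g := by
    ext ⟨x, hx⟩
    rw [LinearMap.mem_ker, Subtype.ext_iff]
    change _ ↔ C.δ i s x = 0
    constructor
    · rintro ⟨y, hy⟩
      rw [show x = C.proj i s y from (congrArg Subtype.val hy).symm]
      exact C.δ_proj i s _ hs
    · intro h0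
      obtain ⟨y, hy, hyx⟩ := C.exists_proj_eq_of_degree hs hx.1 h0
      push_cast at hy
      rw [add_sub_cancel_right] at hy
      exact ⟨⟨y, y, hy⟩, Subtype.ext hyx⟩
  have e : LinearMap.ker g ≃ₗ[k] Z ⧸ W.submoduleOf Z :=
    (LinearEquiv.ofEq _ _ hrange.symm).trans (q.quotKerEquivRange.symm.trans
      ((Submodule.quotEquivOfEq _ _ hker).trans (r.quotKerEquivOfSurjective hr)))
  have hkfin : Module.Finite k (LinearMap.ker g) := Module.Finite.equiv e.symm
  have hB₁ : Module.Finite k B₁ := by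
    have h1 : Module.Finite k (B₁ ⧸ LinearMap.ker g) :=
      Module.Finite.equiv (g.quotKerEquivOfSurjective hg).symm
    exact Module.Finite.of_submodule_quotient (LinearMap.ker g)
  refine ⟨hB₁, ?_⟩
  rw [← LinearMap.finrank_range_add_finrank_ker g, LinearMap.range_eq_top.2 hg, finrank_top,
    e.finrank_eq]

/-- The dimension formula for `B`. -/
theorem finite_and_finrank_B (Z : ∀ n, Submodule k (H n 0)) (W : ∀ n, ℕ → Submodule k (H n 0))
    (hZ : ∀ n y, y ∈ Z n ↔ (C.D n 0).p 0 y = y) [∀ n, Module.Finite k (Z n)]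
    (hW : ∀ n, ∀ s < d, ∀ y ∈ Z n, y ∈ W n s ↔ ∃ y', (C.D n 0).p (-1) y' = y' ∧
      (∀ p < s, θ p • y' = 0) ∧ θ s • y' = y) {s : ℕ} (hs : s ≤ d) (i n : ℕ) (h : i + s = n) :
    Module.Finite k (C.B s i n h) ∧ Module.finrank k (C.B s i n h) =
      ∑ p ∈ Finset.range s,
        Module.finrank k (Z (i + s - 1) ⧸ (W (i + s - 1) p).submoduleOf (Z (i + s - 1))) := by
  induction s generalizing i with
  | zero =>
    obtain rfl : i = n := h
    have h0 : C.B 0 i i rfl = ⊥ := (Submodule.eq_bot_iff _).2 fun x hx =>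
      (C.phi_zero i rfl x).symm.trans hx.2
    rw [h0]
    exact ⟨inferInstance, finrank_bot _ _⟩
  | succ s ih =>
    obtain ⟨hfin, hrank⟩ := ih (by omega) (i + 1) (by omega)
    obtain ⟨hfin', hrank'⟩ := C.finite_and_finrank_B_succ (by omega) i (i + s) n rfl h
      (Z (i + s)) (W (i + s) s) (hZ _) (hW _ s (by omega)) hfin
    refine ⟨hfin', ?_⟩
    rw [hrank', hrank, Finset.sum_range_succ, show i + 1 + s - 1 = i + s by omega,
      show i + (s + 1) - 1 = i + s by omega]

theorem X_smul_eq_zero {s : ℕ} (hs : s ≤ d) (i n : ℕ) (h : i + s = n) {x : H i s}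
    (hx : x ∈ C.B s i n h) (v : V) : (X v : MvPolynomial V k) • x = 0 := by
  refine C.eq_zero_of_phi hs i n h ?_ (by rw [map_smul, hx.2, smul_zero])
  have := GradingProj.X_smul_mem v hx.1
  rwa [sub_add_cancel] at this

/-- The properties of the kernels of `θ j` for an abstract tower. Here `𝓜` records the gradings,
`Ann n s` is the annihilator of `θ 0, …, θ (s - 1)` in `H n 0`, and `L n s` is its truncation. -/
theorem exists_kernel_submodule (𝓜 : ∀ i s, ℤ → Submodule k (H i s))
    (h𝓜 : ∀ i s n x, x ∈ 𝓜 i s n ↔ (C.D i s).p n x = x) [∀ n, Module.Finite k (𝓜 n 0 0)]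
    (Ann L : ∀ n, ℕ → Submodule (MvPolynomial V k) (H n 0))
    (hAnn : ∀ n, ∀ s ≤ d, ∀ y, y ∈ Ann n s ↔ ∀ p < s, θ p • y = 0)
    (hL : ∀ n s, L n s = truncGE (𝓜 n 0) (-1) ⊓ Ann n s)
    {j : ℕ} (hj : j < d) (i n : ℕ) (h : i + j = n) (K : Submodule (MvPolynomial V k) (H i j))
    (hK : ∀ x, x ∈ K ↔ θ j • x = 0) (R : H i j → H n 0 → Prop)
    (hR : ∀ x, R x (C.phi j i n h x)) :
    ∃ B : Submodule (MvPolynomial V k) (H i j), B ≤ K ∧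
      (∃ e : truncGE (V := V) (subquotientDeg (𝓜 i j) K B) ((j : ℤ) - 1)
            ≃ₗ[MvPolynomial V k] L n (j + 1),
        (∀ m : ℤ, ∀ x, x.1 ∈ subquotientDeg (𝓜 i j) K B m ↔ (e x : H n 0) ∈ 𝓜 n 0 (m - j)) ∧
        ∀ (x : K) (hx : (B.submoduleOf K).mkQ x ∈
            truncGE (V := V) (subquotientDeg (𝓜 i j) K B) ((j : ℤ) - 1)), R x (e ⟨_, hx⟩)) ∧
      (∀ b ∈ B, b ∈ 𝓜 i j ((j : ℤ) - 1)) ∧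
      (∀ v : V, ∀ b ∈ B, (X v : MvPolynomial V k) • b = 0) ∧
      Module.Finite k B ∧
      Module.finrank k B = ∑ p ∈ Finset.range j, Module.finrank k (𝓜 (i + j - 1) 0 0 ⧸
        (((L (i + j - 1) p).map (LinearMap.lsmul (MvPolynomial V k) (H (i + j - 1) 0)
          (θ p))).restrictScalars k).submoduleOf (𝓜 (i + j - 1) 0 0)) := by
  obtain rfl : L = fun n s => truncGE (𝓜 n 0) (-1) ⊓ Ann n s := funext fun n => funext (hL n)
  have hAnnD : ∀ n, ∀ s ≤ d, ∀ m, ∀ y ∈ Ann n s, (C.D n 0).p m y ∈ Ann n s := by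
    intro n s hs m y hy
    rw [hAnn n s hs] at hy ⊢
    intro p hp
    rw [← C.D_smul, hy p hp, map_zero]
  have hBfin := C.finite_and_finrank_B (fun n => 𝓜 n 0 0)
    (fun n p => ((truncGE (𝓜 n 0) (-1) ⊓ Ann n p).map
      (LinearMap.lsmul (MvPolynomial V k) (H n 0) (θ p))).restrictScalars k)
    (fun n y => h𝓜 n 0 0 y) (by
      intro n s hs y hy
      rw [Submodule.restrictScalars_mem]
      constructor
      · rintro ⟨x, ⟨-, hx⟩, rfl⟩
        refine ⟨(C.D n 0).p (-1) x, (C.D n 0).idem _ _,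
          (hAnn n s hs.le _).1 (hAnnD n s hs.le (-1) x hx), ?_⟩
        rw [← C.D_smul]
        exact (h𝓜 n 0 0 _).1 hy
      · rintro ⟨y', hy', hθ, rfl⟩
        exact ⟨y', ⟨mem_truncGE_of_mem le_rfl ((h𝓜 n 0 (-1) y').2 hy'),
          (hAnn n s hs.le _).2 hθ⟩, rfl⟩) hj.le i n h
  let B : Submodule (MvPolynomial V k) (H i j) :=
    { C.B j i n h with
      smul_mem' := by
        intro f x hx
        change f • x ∈ C.B j i n h
        induction f using MvPolynomial.induction_on with
        | C c =>
          rw [← MvPolynomial.algebraMap_eq, algebraMap_smul]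
          exact Submodule.smul_mem _ c hx
        | add p q hp hq =>
          rw [add_smul]
          exact Submodule.add_mem _ hp hq
        | mul_X p v _ =>
          rw [mul_smul, C.X_smul_eq_zero hj.le i n h hx v, smul_zero]
          exact Submodule.zero_mem _ }
  refine ⟨B, ?_, ?_, fun b hb => (h𝓜 i j _ b).2 hb.1,
    fun v b hb => C.X_smul_eq_zero hj.le i n h hb v, hBfin.1, hBfin.2⟩
  · rintro b ⟨hb, hb0⟩
    rw [hK]
    refine C.eq_zero_of_phi hj.le i n h (C.D_smul_eq hb) ?_
    rw [map_smul, hb0, smul_zero]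
  · obtain ⟨e, he, heφ⟩ := exists_truncGE_equiv (C.D i j) (C.D n 0) (h𝓜 i j) (h𝓜 n 0)
      (C.phi j i n h) j (C.phi_D hj.le i n h) (fun m hm x => C.D_eq_zero hj.le i hm x)
      (fun m hm y => C.top n m y hm) (fun x hx h0 => C.eq_zero_of_phi hj.le i n h hx h0) K B
      (fun b => Iff.rfl) (Ann n (j + 1)) (hAnnD n (j + 1) hj) (by
        intro a ha
        rw [hAnn n _ hj]
        intro p hp
        rcases (Nat.lt_succ_iff.1 hp).lt_or_eq with hpj | rfl
        · exact C.smul_phi hj.le i n h a hpj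
        · rw [← map_smul, (hK a).1 ha, map_zero]) (by
        intro y hy hy1
        rw [hAnn n _ hj] at hy
        obtain ⟨x, hx, rfl⟩ := C.exists_phi_eq_of_smul hj.le i n h hy1 fun p hp => hy p (by omega)
        refine ⟨x, ?_, hx, rfl⟩
        rw [hK]
        refine C.eq_zero_of_phi hj.le i n h (C.D_smul_eq hx) ?_
        rw [map_smul, hy j (Nat.lt_succ_self _)]) (by
        intro y hy
        obtain ⟨x, hx, rfl⟩ := C.exists_phi_eq_top hj.le i n h hy
        refine ⟨x, ?_, hx, rfl⟩
        rw [hK]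
        exact C.eq_zero_of_degree (m := j + 1) hj.le (by omega)
          (C.D_smul_eq (by rwa [add_sub_cancel_right])))
    refine ⟨e, he, fun x hx => ?_⟩
    rw [heφ x hx]
    exact hR x

end ConnectingTower

/-! ### The tower of quotients of a Stanley–Reisner ring -/

section StanleyReisner

variable {k V : Type*} [Field k]

theorem isWeightedHomogeneous_prod_X {G : Type*} [AddCommMonoid G] (w : V → G) (F : Finset V) :
    IsWeightedHomogeneous w (∏ v ∈ F, X v : MvPolynomial V k) (∑ v ∈ F, w v) :=
  IsWeightedHomogeneous.prod F _ _ fun v _ => isWeightedHomogeneous_X k w v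

variable [Fintype V] (Δ : PreAbstractSimplicialComplex V) {d : ℕ} (Θ : Fin d → V → k)

theorem isWeightedHomogeneous_linForm (a : V → k) :
    IsWeightedHomogeneous (fun _ => (1 : ℤ)) (linForm a) 1 := by
  refine IsWeightedHomogeneous.sum _ _ _ fun v _ => ?_
  rw [← zero_add (1 : ℤ)]
  exact (isWeightedHomogeneous_C _ _).mul (isWeightedHomogeneous_X k _ v)

theorem paramIdeal_component_mem (s : ℕ) (n : ℤ) (f : MvPolynomial V k)
    (hf : f ∈ paramIdeal Δ Θ s) :
    weightedHomogeneousComponent (fun _ => (1 : ℤ)) n f ∈ paramIdeal Δ Θ s := by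
  rw [paramIdeal, stanleyReisnerIdeal, ← Ideal.span_union] at hf ⊢
  refine GradingProj.weightedHomogeneousComponent_mem_span _ _ ?_ n f hf
  rintro _ (⟨F, -, -, rfl⟩ | ⟨p, -, rfl⟩)
  · exact ⟨_, isWeightedHomogeneous_prod_X _ F⟩
  · exact ⟨_, isWeightedHomogeneous_linForm _⟩

theorem paramIdeal_zero : paramIdeal Δ Θ 0 = stanleyReisnerIdeal k Δ := by
  have : {f : MvPolynomial V k | ∃ p : Fin d, (p : ℕ) < 0 ∧ f = linForm (Θ p)} = ∅ := by
    ext f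
    simp
  rw [paramIdeal, this, Ideal.span_empty, sup_bot_eq]

theorem isSquarefreeMonomial_paramIdeal_zero [DecidableEq V] :
    IsSquarefreeMonomial (paramIdeal Δ Θ 0) := by
  rw [paramIdeal_zero]
  constructor
  · intro g f hf
    refine GradingProj.weightedHomogeneousComponent_mem_span _ _ ?_ g f hf
    rintro _ ⟨F, -, -, rfl⟩
    exact ⟨_, isWeightedHomogeneous_prod_X _ F⟩
  · have hspan : stanleyReisnerIdeal k Δ = Ideal.span ((fun a => monomial a (1 : k)) ''
        {a | ∃ F : Finset V, F.Nonempty ∧ F ∉ Δ ∧ a = ∑ v ∈ F, Finsupp.single v 1}) := by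
      rw [stanleyReisnerIdeal]
      congr 1
      ext f
      constructor
      · rintro ⟨F, hF, hFΔ, rfl⟩
        exact ⟨_, ⟨F, hF, hFΔ, rfl⟩, monomial_sum_one F _⟩
      · rintro ⟨_, ⟨F, hF, hFΔ, rfl⟩, rfl⟩
        exact ⟨F, hF, hFΔ, monomial_sum_one F _⟩
    intro a b hab ha
    rw [hspan, mem_ideal_span_monomial_image] at ha ⊢
    intro b' hb'
    have hbb' : b = b' := by
      classical
      rw [support_monomial, if_neg one_ne_zero, Finset.mem_singleton] at hb'
      exact hb'.symm
    subst hbb'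
    obtain ⟨_, ⟨F, hF, hFΔ, rfl⟩, hle⟩ := ha a (by
      classical
      rw [support_monomial, if_neg one_ne_zero, Finset.mem_singleton])
    refine ⟨_, ⟨F, hF, hFΔ, rfl⟩, fun v => ?_⟩
    have h1 : (∑ u ∈ F, Finsupp.single u 1 : V →₀ ℕ) v = if v ∈ F then 1 else 0 := by
      rw [Finsupp.finsetSum_apply]
      simp [Finsupp.single_apply]
    have h2 := hle v
    rw [h1] at h2 ⊢
    split_ifs with hv
    · rw [if_pos hv] at h2
      have : v ∈ b.support := hab (Finsupp.mem_support_iff.2 (by omega))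
      exact Nat.one_le_iff_ne_zero.2 (Finsupp.mem_support_iff.1 this)
    · exact Nat.zero_le _

/-- The standard grading of `k[Δ] / (θ_1, …, θ_s)`. -/
def srGrading (s : ℕ) : GradingProj (k := k) (fun _ : V => (1 : ℤ)) (SRQuotient Δ Θ s) :=
  GradingProj.quotient _ _ (paramIdeal_component_mem Δ Θ s)

variable {Δ Θ}

theorem factor_srGrading (s : ℕ) (n : ℤ) (x : SRQuotient Δ Θ s) :
    Submodule.factor (paramIdeal_le_succ Δ Θ s) ((srGrading Δ Θ s).p n x) =
      (srGrading Δ Θ (s + 1)).p n (Submodule.factor (paramIdeal_le_succ Δ Θ s) x) := by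
  obtain ⟨f, rfl⟩ := Ideal.Quotient.mk_surjective x
  have h : ∀ g, Submodule.factor (paramIdeal_le_succ Δ Θ s) (Ideal.Quotient.mk _ g) =
      Ideal.Quotient.mk _ g := fun g => rfl
  rw [srGrading, srGrading, GradingProj.quotient_mk, h, h, GradingProj.quotient_mk]

/-- The linear forms, extended by zero to a sequence. -/
def thetaSeq (Θ : Fin d → V → k) (s : ℕ) : MvPolynomial V k :=
  if h : s < d then linForm (Θ ⟨s, h⟩) else 0

theorem thetaSeq_of_lt (Θ : Fin d → V → k) {s : ℕ} (h : s < d) :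
    thetaSeq Θ s = linForm (Θ ⟨s, h⟩) := dif_pos h

theorem GradingProj.thetaSeq_smul {M : Type*} [AddCommGroup M] [Module k M]
    [Module (MvPolynomial V k) M] [IsScalarTower k (MvPolynomial V k) M]
    (D : GradingProj (k := k) (V := V) (fun _ => (1 : ℤ)) M) (s : ℕ) (n : ℤ) (x : M) :
    D.p (n + 1) (thetaSeq Θ s • x) = thetaSeq Θ s • D.p n x := by
  by_cases h : s < d
  · rw [thetaSeq_of_lt Θ h, D.linForm_smul]
  · rw [thetaSeq, dif_neg h, zero_smul, zero_smul, map_zero]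

theorem loc_linForm_smul {M : Type*} [AddCommGroup M] [Module k M]
    [Module (MvPolynomial V k) M] [IsScalarTower k (MvPolynomial V k) M]
    (D : GradingProj (k := k) (V := V) (fun _ => (1 : ℤ)) M) (a : V → k) (n : ℤ)
    (c : Cech (V := V) k M) : D.cech (n + 1) (linForm a • c) = linForm a • D.cech n c := by
  funext S
  rw [GradingProj.cech_apply, Pi.smul_apply, Pi.smul_apply, GradingProj.cech_apply]
  induction c S using LocalizedModule.induction_on with
  | _ m s => rw [LocalizedModule.smul'_mk, D.loc_mk, D.loc_mk, LocalizedModule.smul'_mk,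
      add_right_comm, D.linForm_smul]

variable (Δ Θ) [LinearOrder V]

theorem mem_mDeg (i s : ℕ) (n : ℤ) (x : MCoh Δ Θ i s) :
    x ∈ mDeg Δ Θ i s n ↔ (((srGrading Δ Θ s).coh i).p n x) = x :=
  GradingProj.mem_cohDeg _ (fun n x => GradingProj.mem_quotientDeg _ _ n x) i n x

variable {Δ Θ}

/-- The sequence is filter-regular: an element of a localization that `θ_{s+1}` kills is already
zero, as one of the inverted variables has a power that kills it. -/
theorem filterRegular (hΘ : FaceMinorsNonzero Δ Θ) (s : Fin d) :
    FilterRegular (Submodule.factor (paramIdeal_le_succ Δ Θ s)) (linForm (Θ s)) where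
  surjective := Submodule.factor_surjective _
  exact m hm := by
    obtain ⟨f, rfl⟩ := Ideal.Quotient.mk_surjective m
    have hf : f ∈ paramIdeal Δ Θ (s + 1) := Ideal.Quotient.eq_zero_iff_mem.1 hm
    have hle : paramIdeal Δ Θ (s + 1) ≤ paramIdeal Δ Θ s ⊔ Ideal.span {linForm (Θ s)} := by
      rw [paramIdeal, paramIdeal, sup_assoc, ← Ideal.span_union]
      refine sup_le_sup_left (Ideal.span_mono ?_) _
      rintro _ ⟨p, hp, rfl⟩
      rcases (Nat.lt_succ_iff.1 hp).lt_or_eq with h | h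
      · exact Or.inl ⟨p, h, rfl⟩
      · exact Or.inr (by rw [Fin.ext h]; rfl)
    obtain ⟨g, hg, g', hg', rfl⟩ := Submodule.mem_sup.1 (hle hf)
    obtain ⟨r, rfl⟩ := Ideal.mem_span_singleton.1 hg'
    refine ⟨Ideal.Quotient.mk _ r, ?_⟩
    rw [map_add, Ideal.Quotient.eq_zero_iff_mem.2 hg, zero_add]
    rfl
  map_smul_eq_zero m := by
    obtain ⟨f, rfl⟩ := Ideal.Quotient.mk_surjective m
    change Ideal.Quotient.mk (paramIdeal Δ Θ (s + 1)) (linForm (Θ s) * f) = 0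
    rw [Ideal.Quotient.eq_zero_iff_mem]
    exact Ideal.mul_mem_right _ _
      (Ideal.mem_sup_right (Ideal.subset_span ⟨s, Nat.lt_succ_self _, rfl⟩))
  injective S hS x hx := by
    induction x using LocalizedModule.induction_on with
    | _ m t =>
      obtain ⟨f, rfl⟩ := Ideal.Quotient.mk_surjective m
      rw [LocalizedModule.smul'_mk, ← LocalizedModule.zero_mk (1 : monomialsOn k S),
        LocalizedModule.mk_eq] at hx
      obtain ⟨u, hu⟩ := hx
      rw [one_smul, smul_zero, smul_zero, Submonoid.smul_def, smul_comm] at hu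
      have hu' : linForm (Θ s) * ((u : MvPolynomial V k) * f) ∈ paramIdeal Δ Θ s :=
        Ideal.Quotient.eq_zero_iff_mem.1 hu
      obtain ⟨v, hv⟩ := hS
      obtain ⟨n, hn⟩ := exists_pow_mul_mem_paramIdeal hΘ s hu' v
      rw [← LocalizedModule.zero_mk (1 : monomialsOn k S), LocalizedModule.mk_eq]
      refine ⟨⟨X v, Submonoid.subset_closure ⟨v, hv, rfl⟩⟩ ^ n * u, ?_⟩
      rw [one_smul, smul_zero, smul_zero]
      rw [← mul_assoc] at hn
      exact Ideal.Quotient.eq_zero_iff_mem.2 hn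

section Tower

-- Shortcuts that spare the search for the module structure of a quotient of submodules of a product
-- of localizations. They are local, since they only serve the construction of the tower.
abbrev addCommGroupMCoh (i s : ℕ) : AddCommGroup (MCoh Δ Θ i s) := inferInstance

abbrev scalarModuleMCoh (i s : ℕ) : Module k (MCoh Δ Θ i s) := inferInstance

abbrev polynomialModuleMCoh (i s : ℕ) : Module (MvPolynomial V k) (MCoh Δ Θ i s) := inferInstance

theorem isScalarTowerMCoh (i s : ℕ) :
    IsScalarTower k (MvPolynomial V k) (MCoh Δ Θ i s) := inferInstance

attribute [local instance] addCommGroupMCoh scalarModuleMCoh polynomialModuleMCoh isScalarTowerMCoh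

/-- The connecting homomorphism `M^i(s + 1) → M^{i+1}(s)` (zero for `s ≥ d`). -/
def srDelta (hΘ : FaceMinorsNonzero Δ Θ) (i s : ℕ) :
    MCoh Δ Θ i (s + 1) →ₗ[MvPolynomial V k] MCoh Δ Θ (i + 1) s :=
  if h : s < d then (filterRegular hΘ ⟨s, h⟩).delta i else 0

theorem srDelta_of_lt (hΘ : FaceMinorsNonzero Δ Θ) (i : ℕ) {s : ℕ} (h : s < d) :
    srDelta hΘ i s = (filterRegular hΘ ⟨s, h⟩).delta i := dif_pos h

/-- The modules `M^i(s)` with the maps of their long exact sequences. -/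
def srTower (hΘ : FaceMinorsNonzero Δ Θ) :
    @ConnectingTower k V _ d (thetaSeq Θ) (fun i s => MCoh Δ Θ i s) (fun _ _ => inferInstance)
      (fun _ _ => inferInstance) (fun _ _ => inferInstance) (fun _ _ => inferInstance) where
  D i s := (srGrading Δ Θ s).coh i
  proj i s := cohMap (Submodule.factor (paramIdeal_le_succ Δ Θ s)) i
  δ i s := srDelta hΘ i s
  D_smul i s s' n x := GradingProj.thetaSeq_smul _ s' n x
  D_proj i s n x := GradingProj.cohMap_coh (factor_srGrading s) i n x
  D_δ i s n x hs := by
    rw [srDelta_of_lt hΘ i hs]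
    exact (filterRegular hΘ ⟨s, hs⟩).delta_coh (srGrading Δ Θ s) (srGrading Δ Θ (s + 1))
      (factor_srGrading s) (loc_linForm_smul _ _) i n x
  proj_smul i s x hs := by
    rw [thetaSeq_of_lt Θ hs]
    exact (filterRegular hΘ ⟨s, hs⟩).cohMap_smul i x
  exists_smul_eq i s x hs hx := by
    rw [thetaSeq_of_lt Θ hs]
    exact (filterRegular hΘ ⟨s, hs⟩).exists_smul_eq_of_cohMap hx
  δ_proj i s x hs := by
    rw [srDelta_of_lt hΘ i hs]
    exact (filterRegular hΘ ⟨s, hs⟩).delta_cohMap i x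
  exists_proj_eq i s x hs hx := by
    rw [srDelta_of_lt hΘ i hs] at hx
    exact (filterRegular hΘ ⟨s, hs⟩).exists_cohMap_eq hx
  smul_δ i s x hs := by
    rw [srDelta_of_lt hΘ i hs, thetaSeq_of_lt Θ hs]
    exact (filterRegular hΘ ⟨s, hs⟩).smul_delta i x
  exists_δ_eq i s x hs hx := by
    rw [thetaSeq_of_lt Θ hs] at hx
    rw [srDelta_of_lt hΘ i hs]
    exact (filterRegular hΘ ⟨s, hs⟩).exists_delta_eq hx
  top i n x hn := (isSquarefreeMonomial_paramIdeal_zero Δ Θ).coh_eq_zero _ hn i x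

theorem iterConnecting_phi (hΘ : FaceMinorsNonzero Δ Θ) {s : ℕ} (hs : s ≤ d) (i n : ℕ)
    (h : i + s = n) (x : MCoh Δ Θ i s) :
    IterConnecting Δ Θ s i n x ((srTower hΘ).phi s i n h x) := by
  induction s generalizing i with
  | zero =>
    obtain rfl : i = n := h
    rw [ConnectingTower.phi_zero]
    exact IterConnecting.zero i x
  | succ s ih =>
    rw [ConnectingTower.phi_succ]
    refine IterConnecting.succ s i n hs x _ _ ?_ (ih (by omega) (i + 1) (by omega) _)
    change Connecting _ _ i x (srDelta hΘ i s x)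
    rw [srDelta_of_lt hΘ i hs]
    exact (filterRegular hΘ ⟨s, hs⟩).connecting_delta i x

end Tower

variable (Δ Θ)

theorem finite_mDeg_zero (n : ℕ) : Module.Finite k (mDeg Δ Θ n 0 0) :=
  (isSquarefreeMonomial_paramIdeal_zero Δ Θ).finite_of_coh_zero _ n _
    fun x hx => (mem_mDeg Δ Θ n 0 0 x).1 hx

theorem finite_CokerL (n : ℕ) (p : Fin d) : Module.Finite k (CokerL Δ Θ n p) := by
  have := finite_mDeg_zero Δ Θ n
  infer_instance

/-- The annihilator of `θ_1, …, θ_s` in `H^i_𝔪(k[Δ])`. -/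
def thetaAnn (i s : ℕ) : Submodule (MvPolynomial V k) (MCoh Δ Θ i 0) :=
  ⨅ (p : Fin d) (_ : (p : ℕ) < s),
    LinearMap.ker (LinearMap.lsmul (MvPolynomial V k) (MCoh Δ Θ i 0) (linForm (Θ p)))

variable {Δ Θ}

theorem mem_thetaAnn {i s : ℕ} (hs : s ≤ d) {x : MCoh Δ Θ i 0} :
    x ∈ thetaAnn Δ Θ i s ↔ ∀ p < s, thetaSeq Θ p • x = 0 := by
  simp only [thetaAnn, Submodule.mem_iInf, LinearMap.mem_ker, LinearMap.lsmul_apply]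
  constructor
  · intro h p hp
    rw [thetaSeq_of_lt Θ (by omega)]
    exact h ⟨p, by omega⟩ hp
  · intro h p hp
    rw [← thetaSeq_of_lt Θ p.2]
    exact h p hp

theorem exists_kernel_submodule (hΘ : FaceMinorsNonzero Δ Θ) (i : ℕ) (j : Fin d) :
    ∃ B : Submodule (MvPolynomial V k) (MCoh Δ Θ i j),
      B ≤ kerMul Δ Θ i j ∧
      -- the isomorphism of graded modules, induced by iterated connecting homomorphisms
      (∃ e : truncGE (V := V) (subquotientDeg (mDeg Δ Θ i j) (kerMul Δ Θ i j) B) ((j : ℤ) - 1)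
            ≃ₗ[MvPolynomial V k] LSub Δ Θ (i + j) (j + 1),
        (∀ n : ℤ, ∀ x, x.1 ∈ subquotientDeg (mDeg Δ Θ i j) (kerMul Δ Θ i j) B n ↔
            (e x : MCoh Δ Θ (i + j) 0) ∈ mDeg Δ Θ (i + j) 0 (n - j)) ∧
        ∀ (x : kerMul Δ Θ i j)
          (hx : (B.submoduleOf (kerMul Δ Θ i j)).mkQ x ∈ truncGE (V := V)
            (subquotientDeg (mDeg Δ Θ i j) (kerMul Δ Θ i j) B) ((j : ℤ) - 1)),
          IterConnecting Δ Θ j i (i + j) x (e ⟨_, hx⟩)) ∧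
      -- concentration in a single degree, and triviality of the module structure
      (∀ b ∈ B, b ∈ mDeg Δ Θ i j ((j : ℤ) - 1)) ∧
      (∀ (v : V), ∀ b ∈ B, (MvPolynomial.X v : MvPolynomial V k) • b = 0) ∧
      -- the dimension formula
      Module.Finite k B ∧
      (∀ p : Fin d, p < j → Module.Finite k (CokerL Δ Θ (i + j - 1) p)) ∧
      Module.finrank k B =
        ∑ p : Fin d with p < j, Module.finrank k (CokerL Δ Θ (i + j - 1) p) := by
  refine (@ConnectingTower.exists_kernel_submodule k V _ d (thetaSeq Θ) (fun i s => MCoh Δ Θ i s)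
    addCommGroupMCoh scalarModuleMCoh polynomialModuleMCoh isScalarTowerMCoh (srTower hΘ)
    (mDeg Δ Θ) (mem_mDeg Δ Θ) (finite_mDeg_zero Δ Θ) (thetaAnn Δ Θ) (LSub Δ Θ)
    (fun _ _ hs _ => mem_thetaAnn hs) (fun _ _ => rfl) j j.2 i (i + j) rfl (kerMul Δ Θ i j)
    (fun x => by rw [thetaSeq_of_lt Θ j.2]; rfl) (IterConnecting Δ Θ j i (i + j))
    (iterConnecting_phi hΘ j.2.le i (i + j) rfl)).imp fun B hB =>
    ⟨hB.1, hB.2.1, hB.2.2.1, hB.2.2.2.1, hB.2.2.2.2.1, fun p _ => finite_CokerL Δ Θ _ p,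
      hB.2.2.2.2.2.trans ?_⟩
  symm
  refine Finset.sum_bij (fun p _ => (p : ℕ)) ?_ (fun _ _ _ _ h => Fin.ext h) ?_ ?_
  · intro p hp
    exact Finset.mem_range.2 (Finset.mem_filter.1 hp).2
  · intro p hp
    have hpj := Finset.mem_range.1 hp
    exact ⟨⟨p, hpj.trans j.2⟩, Finset.mem_filter.2 ⟨Finset.mem_univ _, hpj⟩, rfl⟩
  · intro p _
    rw [thetaSeq_of_lt Θ p.2]

end StanleyReisner

end

end SRCohomology

open SRCohomology in
/-- Indices start at `0`: the linear forms are `θ_{p+1} = linForm (Θ p)`, and `j : Fin d` stands for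
the index `j + 1 ∈ {1, …, d}`. "Generic" means: for all coefficient matrices `Θ` in a nonempty
Zariski open set `{P ≠ 0}` of matrices. -/
theorem proposition3p4 {k V : Type*} [Field k] [Infinite k] [Fintype V] [LinearOrder V]
    (Δ : PreAbstractSimplicialComplex V) (d : ℕ)
    (hd : IsGreatest {n : ℕ | ∃ F : Finset V, (F = ∅ ∨ F ∈ Δ) ∧ F.card = n} d) :
    ∃ P : MvPolynomial (Fin d × V) k, P ≠ 0 ∧
      ∀ Θ : Fin d → V → k, MvPolynomial.eval (fun q => Θ q.1 q.2) P ≠ 0 →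
        IsLSOP Δ Θ ∧
        ∀ (i : ℕ) (j : Fin d),
          ∃ B : Submodule (MvPolynomial V k) (MCoh Δ Θ i j),
            B ≤ kerMul Δ Θ i j ∧
            -- the isomorphism of graded modules, induced by iterated connecting homomorphisms
            (∃ e : truncGE (V := V) (subquotientDeg (mDeg Δ Θ i j) (kerMul Δ Θ i j) B) ((j : ℤ) - 1)
                  ≃ₗ[MvPolynomial V k] LSub Δ Θ (i + j) (j + 1),
              (∀ n : ℤ, ∀ x, x.1 ∈ subquotientDeg (mDeg Δ Θ i j) (kerMul Δ Θ i j) B n ↔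
                  (e x : MCoh Δ Θ (i + j) 0) ∈ mDeg Δ Θ (i + j) 0 (n - j)) ∧
              ∀ (x : kerMul Δ Θ i j)
                (hx : (B.submoduleOf (kerMul Δ Θ i j)).mkQ x ∈ truncGE (V := V)
                  (subquotientDeg (mDeg Δ Θ i j) (kerMul Δ Θ i j) B) ((j : ℤ) - 1)),
                IterConnecting Δ Θ j i (i + j) x (e ⟨_, hx⟩)) ∧
            -- concentration in a single degree, and triviality of the module structure
            (∀ b ∈ B, b ∈ mDeg Δ Θ i j ((j : ℤ) - 1)) ∧
            (∀ (v : V), ∀ b ∈ B, (MvPolynomial.X v : MvPolynomial V k) • b = 0) ∧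
            -- the dimension formula
            Module.Finite k B ∧
            (∀ p : Fin d, p < j → Module.Finite k (CokerL Δ Θ (i + j - 1) p)) ∧
            Module.finrank k B =
              ∑ p : Fin d with p < j, Module.finrank k (CokerL Δ Θ (i + j - 1) p) := by
  exact (exists_eval_ne_zero_faceMinorsNonzero k Δ d fun F hF => hd.2 ⟨F, Or.inr hF, rfl⟩).imp
    fun P hP => ⟨hP.1, fun Θ hΘ => ⟨isLSOP_of_faceMinorsNonzero (hP.2 Θ hΘ),
      exists_kernel_submodule (hP.2 Θ hΘ)⟩⟩
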